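/- Let $d\ge 1$ and let $\mathbf X=(X_t:t\ge 0)$ be a pure jump Lévy process on $\mathbb R^d$ (càdlàg, $X_0=0$ almost surely, independent and stationary increments) which is isotropic unimodal: for every $t>0$ the law of $X_t$ is absolutely continuous on $\mathbb R^d\setminus\{0\}$ with a radial and radially non-increasing density $p(t,\cdot)$ (an atom at $0$ is allowed, and $p(t,0)$ may be infinite). Let $\psi$ be its Lévy–Khintchine exponent, that is, $\mathbb E\,e^{i\langle \xi,X_t\rangle}=e^{-t\psi(\xi)}$ with $\psi(\xi)=\int_{\mathbb R^d}(1-\cos\langle\xi,x\rangle)\,\nu(dx)$ for a Lévy measure $\nu$ (so $\nu(\{0\})=0$ and $\int\min(1,|x|^2)\,\nu(dx)<\infty$); $\psi$ is radial, and $\psi(r)$ denotes its value at any $\xi$ with $|\xi|=r$. Let $a>0$ and let $\ell:[a,\infty)\to[0,\infty)$ be bounded and slowly varying at infinity, that is, $\lim_{r\to\infty}\ell(\lambda r)/\ell(r)=1$ for every $\lambda>0$. Suppose that $\psi$ belongs to the de Haan class $\Pi_\ell^\infty$, that is, $$\lim_{r\to\infty}\frac{\psi(\lambda r)-\psi(r)}{\ell(r)}=\log\lambda\qquad\text{for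 every }\lambda>0 .$$ Then $$\lim_{\substack{t\to0^+\\ t\psi(|x|^{-1})\to\infty}}\frac{p(t,x)}{t\,|x|^{-d}\,\ell(|x|^{-1})\,e^{-t\psi(|x|^{-1})}}=\frac{\Gamma(d/2)}{2\pi^{d/2}},$$ that is, for every $\varepsilon>0$ there are $\delta>0$ and $M>0$ such that for all $t\in(0,\delta)$ and $x\in\mathbb R^d\setminus\{0\}$ with $t\psi(|x|^{-1})>M$ the quotient on the left differs from $\Gamma(d/2)/(2\pi^{d/2})$ by less than $\varepsilon$. -/

import Mathlib

open MeasureTheory ProbabilityTheory Filter Topology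
open scoped NNReal ENNReal

noncomputable section

/-- A Lévy process with values in a normed space `E`: it starts at `0`, has independent and
stationary increments, and has càdlàg paths. -/
structure IsLevyProcess {Ω E : Type*} [MeasurableSpace Ω] [NormedAddCommGroup E]
    [MeasurableSpace E] (X : ℝ≥0 → Ω → E) (P : Measure Ω) : Prop where
  measurable : ∀ t, Measurable (X t)
  start_zero : ∀ᵐ ω ∂P, X 0 ω = 0
  indep_increments : HasIndepIncrements X P
  stationary_increments : ∀ s t : ℝ≥0, P.map (fun ω => X (s + t) ω - X s ω) = P.map (X t)
  cadlag : ∀ᵐ ω ∂P, ∀ t : ℝ≥0,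
    Tendsto (fun s => X s ω) (𝓝[>] t) (𝓝 (X t ω)) ∧
      ∃ l : E, Tendsto (fun s => X s ω) (𝓝[<] t) (𝓝 l)

/-- `f` is a radial and radially non-increasing density of `μ` on `ℝ^d \ {0}`. The value of `f` at
the origin is not restricted (in particular `f 0 = ∞` is allowed), and `μ` may have an atom there.
Radiality off the origin is the case `‖x‖ = ‖y‖` of the second condition. -/
structure IsUnimodalDensity {d : ℕ} (μ : Measure (EuclideanSpace ℝ (Fin d)))
    (f : EuclideanSpace ℝ (Fin d) → ℝ≥0∞) : Prop where
  restrict_eq : μ.restrict {0}ᶜ = (volume.restrict {0}ᶜ).withDensity f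
  antitone : ∀ x y, x ≠ 0 → ‖x‖ ≤ ‖y‖ → f y ≤ f x

/-- A Borel measure on `ℝ^d` is isotropic unimodal if it is absolutely continuous on `ℝ^d \ {0}`
with a radial and radially non-increasing density. -/
def IsIsotropicUnimodal {d : ℕ} (μ : Measure (EuclideanSpace ℝ (Fin d))) : Prop :=
  ∃ f : EuclideanSpace ℝ (Fin d) → ℝ≥0∞, IsUnimodalDensity μ f

/-- An isotropic unimodal Lévy process on `ℝ^d`: all its one-dimensional distributions at positive
times are isotropic unimodal. -/
structure IsIsotropicUnimodalLevyProcess {d : ℕ} {Ω : Type*} [MeasurableSpace Ω]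
    (X : ℝ≥0 → Ω → EuclideanSpace ℝ (Fin d)) (P : Measure Ω) : Prop
    extends IsLevyProcess X P where
  unimodal : ∀ t : ℝ≥0, 0 < t → IsIsotropicUnimodal (P.map (X t))

/-- `ν` is a Lévy measure: no mass at the origin and `∫ min(1, |x|²) ν(dx) < ∞`. -/
structure IsLevyMeasure {d : ℕ} (ν : Measure (EuclideanSpace ℝ (Fin d))) : Prop where
  zero : ν {0} = 0
  lintegral_lt_top : ∫⁻ x, ENNReal.ofReal (min 1 (‖x‖ ^ 2)) ∂ν < ∞

/-- The Lévy–Khintchine exponent `ξ ↦ ∫ (1 - cos ⟨ξ, x⟩) ν(dx)` of a symmetric pure jump Lévy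
process with Lévy measure `ν`. -/
def levyExponent {d : ℕ} (ν : Measure (EuclideanSpace ℝ (Fin d)))
    (ξ : EuclideanSpace ℝ (Fin d)) : ℝ :=
  ∫ x, (1 - Real.cos (inner ℝ ξ x)) ∂ν

/-- The Lévy process `X` is a (symmetric) pure jump process with Lévy measure `ν`: it has neither
drift nor Gaussian part, that is, `E exp(i⟨ξ, X t⟩) = exp(-t ψ(ξ))` where
`ψ(ξ) = ∫ (1 - cos ⟨ξ, x⟩) ν(dx)`. -/
structure IsPureJumpWithLevyMeasure {d : ℕ} {Ω : Type*} [MeasurableSpace Ω]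
    (X : ℝ≥0 → Ω → EuclideanSpace ℝ (Fin d)) (P : Measure Ω)
    (ν : Measure (EuclideanSpace ℝ (Fin d))) : Prop where
  isLevyMeasure : IsLevyMeasure ν
  charFun_eq : ∀ (t : ℝ≥0) (ξ : EuclideanSpace ℝ (Fin d)),
    charFun (P.map (X t)) ξ = Complex.exp (-((t : ℝ) * levyExponent ν ξ : ℝ))

/-- The function `ℓ : [a, ∞) → [0, ∞)`, with `a > 0`, is slowly varying at infinity. (The values
of `ℓ` outside `[a, ∞)` are irrelevant; the limit forces `ℓ` to be non-zero near infinity.) -/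
structure IsSlowlyVaryingAtInfty (a : ℝ) (ℓ : ℝ → ℝ) : Prop where
  pos : 0 < a
  nonneg : ∀ x, a ≤ x → 0 ≤ ℓ x
  tendsto : ∀ c : ℝ, 0 < c → Tendsto (fun x => ℓ (c * x) / ℓ x) atTop (𝓝 1)

/-- The nonnegative function `f` on `[a, ∞)` belongs to the de Haan class at infinity determined
by `ℓ`. -/
structure IsDeHaanAtInfty (a : ℝ) (ℓ f : ℝ → ℝ) : Prop where
  nonneg : ∀ x, a ≤ x → 0 ≤ f x
  tendsto : ∀ c : ℝ, 0 < c → Tendsto (fun x => (f (c * x) - f x) / ℓ x) atTop (𝓝 (Real.log c))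

end

/-! ### De Haan increments in logarithmic coordinates: uniform bounds and linearisation of
exponentials. -/

section DeHaan

variable {f g : ℝ → ℝ}

/-! Put r = 1/|x|, W = t ℓ(r) exp(-tψ(r)) and κ = Γ(d/2)/(2π^{d/2}). The law of X_t, rescaled by y ↦
r y and divided by W, converges away from the origin to κ|y|^{-d} dy. Monotonicity of the density
then turns this weak convergence into convergence at the single point x.

The weak limit is found by testing against differences of Gaussians. By Fubini, the integral of
exp(-(b r|y|)²) against the law is a Gaussian average of exp(-tψ(2br|v|))
(`integral_exp_neg_mul_sq_eq_of_charFun`). Since ℓ is bounded, tℓ(r) → 0, so the de Haan property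
linearises the exponential: exp(-tψ(ru)) - exp(-tψ(r)) is asymptotically -W log u. Averaging at two
scales b and c, the dependence on |v| cancels and the limit is log(c/b)
(`tendsto_gaussian_transform`). By Frullani's integral the measure κ|y|^{-d} dy gives the same
value, κ being the reciprocal of the area of the unit sphere.

These differences suffice: with w = exp(-|y|²), the quantity w^n · w(1-w) is the Gaussian difference
with b² = n+1 and c² = n+2. So all moments in w of the measures weighted by w(1-w) converge, and
Weierstrass approximation on [0,1] extends this to h(w)w(1-w) for continuous h
(`tendsto_integral_comp_of_moments`). Radial bumps supported just outside or just inside |y| = 1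
give the lower and upper bounds.

The analytic difficulty is dominated convergence in v, because u ranges over all of (0,∞). A
Potter-type bound controls ru large; for ru below a fixed threshold the trivial bound 1 is used, and
tψ(r) ≥ 1 keeps W from being too small (`exists_exp_increment_bound`). -/

lemma eventually_pos_of_tendsto_ratio (hg : ∀ h, Tendsto (fun x => g (x + h) / g x) atTop (𝓝 1))
    (hg0 : ∀ᶠ x in atTop, 0 ≤ g x) : ∀ᶠ x in atTop, 0 < g x := by
  filter_upwards [hg0, (hg 0).eventually_ne one_ne_zero] with x hx hne
  refine lt_of_le_of_ne hx fun h0 => hne ?_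
  rw [← h0, div_zero]

lemma eventually_shift_le_mul (hg : ∀ h, Tendsto (fun x => g (x + h) / g x) atTop (𝓝 1))
    (hg0 : ∀ᶠ x in atTop, 0 ≤ g x) (h : ℝ) {c : ℝ} (hc : 1 < c) :
    ∀ᶠ x in atTop, g (x + h) ≤ c * g x := by
  filter_upwards [eventually_pos_of_tendsto_ratio hg hg0, (hg h).eventually_le_const hc]
    with x hx hle
  rwa [div_le_iff₀ hx] at hle

/-- Local boundedness of de Haan increments, by a Baire category argument. -/
lemma exists_local_increment_bound (hf : Continuous f)
    (hfg : ∀ h, Tendsto (fun x => (f (x + h) - f x) / g x) atTop (𝓝 h))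
    (hg : ∀ h, Tendsto (fun x => g (x + h) / g x) atTop (𝓝 1))
    (hg0 : ∀ᶠ x in atTop, 0 ≤ g x) :
    ∃ η > 0, ∃ K ≥ 0, ∀ᶠ x in atTop, ∀ k, |k| ≤ η → |f (x + k) - f x| ≤ K * g x := by
  have hpos := eventually_pos_of_tendsto_ratio hg hg0
  let E : ℕ → Set ℝ := fun n => {h | ∀ x ≥ (n : ℝ), |f (x + h) - f x| ≤ n * g x}
  have hE : ∀ n, IsClosed (E n) := by
    intro n
    have : E n = ⋂ x ≥ (n : ℝ), {h | |f (x + h) - f x| ≤ n * g x} := by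
      ext h; simp [E]
    rw [this]
    refine isClosed_biInter fun x _ => isClosed_le (by fun_prop) continuous_const
  have hU : ⋃ n, E n = Set.univ := by
    refine Set.eq_univ_of_forall fun h => Set.mem_iUnion.2 ?_
    have h1 : ∀ᶠ x in atTop, |(f (x + h) - f x) / g x| < |h| + 1 :=
      (hfg h).abs.eventually_lt_const (by linarith)
    obtain ⟨N, hN⟩ := eventually_atTop.1 (h1.and hpos)
    obtain ⟨n, hn⟩ := exists_nat_ge (max N (|h| + 1))
    refine ⟨n, fun x hx => ?_⟩
    obtain ⟨h2, h3⟩ := hN x (le_trans (le_trans (le_max_left _ _) hn) hx)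
    rw [abs_div, abs_of_pos h3, div_lt_iff₀ h3] at h2
    exact h2.le.trans (mul_le_mul_of_nonneg_right (le_trans (le_max_right _ _) hn) h3.le)
  obtain ⟨n, h0, hh0⟩ := nonempty_interior_of_iUnion_of_closed hE hU
  obtain ⟨η, hη, hball⟩ := Metric.isOpen_iff.1 isOpen_interior h0 hh0
  -- The increment from x to x + k is a difference of two increments based at x - h0, with shifts h0
  -- + k and h0 in the Baire ball. Each is at most n g(x - h0) ≤ 2n g(x), whence 4n.
  refine ⟨η / 2, by linarith, 4 * n, by positivity, ?_⟩
  filter_upwards [eventually_shift_le_mul hg hg0 (-h0) one_lt_two,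
    eventually_ge_atTop ((n : ℝ) + h0)] with x hx1 hx2 k hk
  have hmem : ∀ k, |k| ≤ η / 2 → h0 + k ∈ E n := fun k hk =>
    interior_subset (hball (by simp [Metric.mem_ball]; linarith))
  have e1 := hmem k hk (x + -h0) (by linarith)
  have e2 := hmem 0 (by simp; linarith) (x + -h0) (by linarith)
  rw [show x + -h0 + (h0 + k) = x + k by ring] at e1
  rw [show x + -h0 + (h0 + 0) = x by ring] at e2
  have hn : (0 : ℝ) ≤ n := by positivity
  have := mul_le_mul_of_nonneg_left hx1 hn
  calc |f (x + k) - f x| = |(f (x + k) - f (x + -h0)) - (f x - f (x + -h0))| := by ring_nf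
    _ ≤ _ := abs_sub _ _
    _ ≤ 4 * n * g x := by linarith

/-- Finitely many steps of the Baire length η cover the unit interval; moving the base point by a
fixed amount costs at most a factor 2 in g eventually. -/
lemma exists_increment_bound (hf : Continuous f)
    (hfg : ∀ h, Tendsto (fun x => (f (x + h) - f x) / g x) atTop (𝓝 h))
    (hg : ∀ h, Tendsto (fun x => g (x + h) / g x) atTop (𝓝 1))
    (hg0 : ∀ᶠ x in atTop, 0 ≤ g x) :
    ∃ K ≥ 0, ∀ᶠ x in atTop, ∀ k, 0 ≤ k → k ≤ 1 → |f (x + k) - f x| ≤ K * g x := by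
  obtain ⟨η, hη, K, hK, hloc⟩ := exists_local_increment_bound hf hfg hg hg0
  have key : ∀ N : ℕ, ∃ K' ≥ 0, ∀ᶠ x in atTop, ∀ k, 0 ≤ k → k ≤ N * η →
      |f (x + k) - f x| ≤ K' * g x := by
    intro N
    induction N with
    | zero =>
      refine ⟨0, le_rfl, Eventually.of_forall fun x k h1 h2 => ?_⟩
      have : k = 0 := le_antisymm (by simpa using h2) h1
      simp [this]
    | succ N ih =>
      obtain ⟨K', hK', hN⟩ := ih
      refine ⟨2 * K + K', by positivity, ?_⟩
      filter_upwards [hN, (tendsto_atTop_add_const_right atTop (N * η) tendsto_id).eventually hloc,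
        eventually_shift_le_mul hg hg0 (N * η) one_lt_two, hg0] with x h1 h2 h3 h4 k hk0 hk1
      rcases le_total k (N * η) with hk | hk
      · refine (h1 k hk0 hk).trans ?_
        have : 0 ≤ 2 * K * g x := by positivity
        linarith
      · have e1 := h2 (k - N * η) (by
          rw [abs_of_nonneg (by linarith)]; push_cast at hk1; linarith)
        have e2 := h1 (N * η) (by positivity) le_rfl
        simp only [id_eq] at e1
        rw [show x + N * η + (k - N * η) = x + k by ring] at e1
        have := mul_le_mul_of_nonneg_left h3 hK
        calc |f (x + k) - f x| = |(f (x + k) - f (x + N * η)) + (f (x + N * η) - f x)| := by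
              ring_nf
          _ ≤ _ := abs_add_le _ _
          _ ≤ (2 * K + K') * g x := by linarith
  obtain ⟨N, hN⟩ := exists_nat_ge (1 / η)
  obtain ⟨K', hK', h⟩ := key N
  refine ⟨K', hK', h.mono fun x hx k h0 h1 => hx k h0 (h1.trans ?_)⟩
  rwa [div_le_iff₀ hη] at hN

/-- Telescoping over unit steps: about |y - x| + 2 increments, each at most K times the local value
of g, and g changes by a factor at most e^δ per step in either direction. -/
lemma increment_bound_of_unit_steps {X₀ K δ : ℝ} (hK : 0 ≤ K) (hδ : 0 ≤ δ)
    (h0 : ∀ x ≥ X₀, 0 ≤ g x)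
    (h1 : ∀ x ≥ X₀, ∀ k, 0 ≤ k → k ≤ 1 → |f (x + k) - f x| ≤ K * g x)
    (h2 : ∀ x ≥ X₀, g (x + 1) ≤ Real.exp δ * g x)
    (h3 : ∀ x ≥ X₀, g x ≤ Real.exp δ * g (x + 1)) {x y : ℝ} (hx : X₀ + 1 ≤ x) (hy : X₀ + 1 ≤ y) :
    |f y - f x| ≤ K * (|y - x| + 2) * Real.exp (δ * (|y - x| + 1)) * g x := by
  have up : ∀ n : ℕ, ∀ θ, 0 ≤ θ → θ ≤ 1 → ∀ x ≥ X₀,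
      |f (x + n + θ) - f x| ≤ K * (n + 1) * Real.exp (δ * n) * g x := by
    intro n θ hθ0 hθ1
    induction n with
    | zero => intro x hx; simpa using h1 x hx θ hθ0 hθ1
    | succ n ih =>
      intro x hx
      have e1 := ih (x + 1) (by linarith)
      have e2 := h1 x hx 1 zero_le_one le_rfl
      have e3 := mul_le_mul_of_nonneg_left (h2 x hx) (by positivity : 0 ≤ K * (n + 1) * Real.exp (δ * n))
      have e4 : Real.exp (δ * (n + 1 : ℕ)) = Real.exp (δ * n) * Real.exp δ := by
        rw [← Real.exp_add]; push_cast; ring_nf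
      have e5 : K * g x ≤ K * Real.exp (δ * (n + 1 : ℕ)) * g x := by
        have : 1 ≤ Real.exp (δ * (n + 1 : ℕ)) := Real.one_le_exp (by positivity)
        have := mul_le_mul_of_nonneg_left this (mul_nonneg hK (h0 x hx))
        linarith
      rw [e4] at e5 ⊢
      push_cast
      rw [show x + (n + 1) + θ = x + 1 + n + θ by ring]
      calc _ = |(f (x + 1 + n + θ) - f (x + 1)) + (f (x + 1) - f x)| := by ring_nf
        _ ≤ _ := abs_add_le _ _
        _ ≤ _ := by linarith
  have down : ∀ n : ℕ, ∀ θ, 0 ≤ θ → θ ≤ 1 → ∀ x, X₀ ≤ x - n →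
      |f (x - n + θ) - f x| ≤ K * (n + 1) * Real.exp (δ * n) * g x := by
    intro n θ hθ0 hθ1
    induction n with
    | zero => intro x hx; simpa using h1 x (by simpa using hx) θ hθ0 hθ1
    | succ n ih =>
      intro x hx
      push_cast at hx
      have hx' : X₀ ≤ x - 1 := by have : (0 : ℝ) ≤ n := by positivity
                                  linarith
      have e1 := ih (x - 1) (by linarith)
      have e2 := h1 (x - 1) hx' 1 zero_le_one le_rfl
      have h3' := h3 (x - 1) hx'
      rw [sub_add_cancel] at e2 h3'
      have e3 := mul_le_mul_of_nonneg_left h3'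
        (by positivity : 0 ≤ K * (n + 1) * Real.exp (δ * n))
      have e4 : Real.exp (δ * (n + 1 : ℕ)) = Real.exp (δ * n) * Real.exp δ := by
        rw [← Real.exp_add]; push_cast; ring_nf
      have e5 : K * g (x - 1) ≤ K * Real.exp (δ * n) * g (x - 1) := by
        have : 1 ≤ Real.exp (δ * n) := Real.one_le_exp (by positivity)
        have := mul_le_mul_of_nonneg_left this (mul_nonneg hK (h0 (x - 1) hx'))
        linarith
      have e6 := mul_le_mul_of_nonneg_left h3' (by positivity : 0 ≤ K * Real.exp (δ * n))
      rw [e4]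
      push_cast
      rw [show x - (n + 1) + θ = x - 1 - n + θ by ring]
      calc _ = |(f (x - 1 - n + θ) - f (x - 1)) - (f x - f (x - 1))| := by ring_nf
        _ ≤ _ := abs_sub _ _
        _ ≤ _ := by linarith
  have fin : ∀ n : ℕ, (n : ℝ) ≤ |y - x| + 1 →
      K * (n + 1) * Real.exp (δ * n) * g x ≤
        K * (|y - x| + 2) * Real.exp (δ * (|y - x| + 1)) * g x := by
    intro n hn
    have := h0 x (by linarith)
    have h4 : (n : ℝ) + 1 ≤ |y - x| + 2 := by linarith
    gcongr K * ?_ * Real.exp (δ * ?_) * g x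
  rcases le_total x y with hxy | hxy
  · have hn := Nat.floor_le (sub_nonneg.2 hxy)
    have hn' := Nat.lt_floor_add_one (y - x)
    have := up ⌊y - x⌋₊ (y - x - ⌊y - x⌋₊) (by linarith) (by linarith) x (by linarith)
    rw [show x + (⌊y - x⌋₊ : ℝ) + (y - x - ⌊y - x⌋₊) = y by ring] at this
    exact this.trans (fin _ (by rw [abs_of_nonneg (by linarith)]; linarith))
  -- Going down, the integer part is rounded up, so the walk overshoots y by less than 1 before
  -- returning by θ; the margin in X₀ + 1 ≤ y keeps it above X₀.
  · have hn := Nat.le_ceil (x - y)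
    have hn' := Nat.ceil_lt_add_one (sub_nonneg.2 hxy)
    have := down ⌈x - y⌉₊ (y - x + ⌈x - y⌉₊) (by linarith) (by linarith) x (by linarith)
    rw [show x - (⌈x - y⌉₊ : ℝ) + (y - x + ⌈x - y⌉₊) = y by ring] at this
    exact this.trans (fin _ (by rw [abs_of_nonpos (by linarith)]; linarith))

/-- A Potter-type bound for functions in the de Haan class. -/
lemma exists_potter_bound (hf : Continuous f)
    (hfg : ∀ h, Tendsto (fun x => (f (x + h) - f x) / g x) atTop (𝓝 h))
    (hg : ∀ h, Tendsto (fun x => g (x + h) / g x) atTop (𝓝 1))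
    (hg0 : ∀ᶠ x in atTop, 0 ≤ g x) {δ : ℝ} (hδ : 0 < δ) :
    ∃ C > 0, ∃ X₀, ∀ x ≥ X₀, ∀ y ≥ X₀, 0 < g x ∧
      |f y - f x| ≤ C * Real.exp (δ * |y - x|) * g x := by
  obtain ⟨K, hK, hinc⟩ := exists_increment_bound hf hfg hg hg0
  have hδ2 : 0 < δ / 2 := by linarith
  have hexp : 1 < Real.exp (δ / 2) := Real.one_lt_exp_iff.2 hδ2
  obtain ⟨X₀, hX⟩ := eventually_atTop.1 ((eventually_pos_of_tendsto_ratio hg hg0).and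
    (hinc.and ((eventually_shift_le_mul hg hg0 1 hexp).and
      ((tendsto_atTop_add_const_right atTop 1 tendsto_id).eventually
        (eventually_shift_le_mul hg hg0 (-1) hexp)))))
  -- The unit steps are run at rate δ/2; the spare exp(δ|y - x|/2) absorbs the linear factor |y - x|
  -- + 2 at the cost of 2 + 2/δ.
  refine ⟨(K + 1) * (2 + 2 / δ) * Real.exp (δ / 2), by positivity, X₀ + 1, fun x hx y hy =>
    ⟨(hX x (by linarith)).1, ?_⟩⟩
  refine (increment_bound_of_unit_steps hK hδ2.le (fun x hx => (hX x hx).1.le)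
    (fun x hx => (hX x hx).2.1) (fun x hx => (hX x hx).2.2.1)
    (fun x hx => by simpa using (hX x hx).2.2.2) hx hy).trans ?_
  have hgx := (hX x (by linarith)).1.le
  have hz := abs_nonneg (y - x)
  set z := |y - x|
  have h1 : z + 2 ≤ (2 + 2 / δ) * Real.exp (δ / 2 * z) := by
    have h2 := Real.add_one_le_exp (δ / 2 * z)
    have h3 : (2 + 2 / δ) * (δ / 2 * z + 1) = z + 2 + (δ * z + 2 / δ) := by field_simp; ring
    have h4 : 0 ≤ δ * z + 2 / δ := by positivity
    have h5 := mul_le_mul_of_nonneg_left h2 (by positivity : 0 ≤ 2 + 2 / δ)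
    linarith
  refine mul_le_mul_of_nonneg_right ?_ hgx
  calc K * (z + 2) * Real.exp (δ / 2 * (z + 1))
      ≤ (K + 1) * ((2 + 2 / δ) * Real.exp (δ / 2 * z)) * Real.exp (δ / 2 * (z + 1)) := by
        gcongr; linarith
    _ = (K + 1) * (2 + 2 / δ) * Real.exp (δ / 2) * Real.exp (δ * z) := by
        rw [show δ / 2 * (z + 1) = δ / 2 + δ / 2 * z by ring, Real.exp_add,
          show δ * z = δ / 2 * z + δ / 2 * z by ring, Real.exp_add]
        ring

/-- With g bounded by M, the telescoping argument runs with the constant M in place of g and δ = 0.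
In the original variable, ψ grows at most logarithmically. -/
lemma exists_linear_increment_bound (hf : Continuous f)
    (hfg : ∀ h, Tendsto (fun x => (f (x + h) - f x) / g x) atTop (𝓝 h))
    (hg : ∀ h, Tendsto (fun x => g (x + h) / g x) atTop (𝓝 1))
    (hg0 : ∀ᶠ x in atTop, 0 ≤ g x) {M : ℝ} (hM : ∀ᶠ x in atTop, g x ≤ M) :
    ∃ C > 0, ∃ X₀, ∀ x ≥ X₀, ∀ y ≥ X₀, |f y - f x| ≤ C * (|y - x| + 2) := by
  obtain ⟨K, hK, hinc⟩ := exists_increment_bound hf hfg hg hg0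
  obtain ⟨X₀, hX⟩ := eventually_atTop.1 (hinc.and (hM.and hg0))
  have hM0 : 0 ≤ M := (hX X₀ le_rfl).2.2.trans (hX X₀ le_rfl).2.1
  refine ⟨(K + 1) * (M + 1), by positivity, X₀ + 1, fun x hx y hy => ?_⟩
  refine (increment_bound_of_unit_steps (g := fun _ => M) hK le_rfl (fun _ _ => hM0)
    (fun x hx k h1 h2 => ((hX x hx).1 k h1 h2).trans
      (mul_le_mul_of_nonneg_left (hX x hx).2.1 hK)) (by simp) (by simp) hx hy).trans ?_
  have hz := abs_nonneg (y - x)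
  rw [zero_mul, Real.exp_zero]
  have h1 : K * M ≤ (K + 1) * (M + 1) := by nlinarith
  have := mul_le_mul_of_nonneg_right h1 (by linarith : 0 ≤ |y - x| + 2)
  linarith

lemma abs_exp_sub_one_le_mul_exp (z : ℝ) : |Real.exp z - 1| ≤ |z| * Real.exp |z| := by
  have h1 := Real.add_one_le_exp z
  have h2 := Real.add_one_le_exp (-z)
  have h3 : Real.exp z * Real.exp (-z) = 1 := by rw [← Real.exp_add]; simp
  have hp := Real.exp_pos z
  rcases le_total 0 z with hz | hz
  · rw [abs_of_nonneg hz, abs_of_nonneg (by linarith)]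
    nlinarith
  · rw [abs_of_nonpos hz, abs_of_nonpos (by linarith [Real.exp_le_one_iff.2 hz])]
    have : 1 ≤ Real.exp (-z) := Real.one_le_exp (by linarith)
    nlinarith

lemma abs_exp_neg_sub_exp_neg_le (α β : ℝ) :
    |Real.exp (-α) - Real.exp (-β)| ≤ Real.exp (-β) * (|α - β| * Real.exp |α - β|) := by
  have h : Real.exp (-α) - Real.exp (-β) = Real.exp (-β) * (Real.exp (β - α) - 1) := by
    rw [mul_sub, ← Real.exp_add]; ring_nf
  rw [h, abs_mul, abs_of_pos (Real.exp_pos _), abs_sub_comm α β]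
  exact mul_le_mul_of_nonneg_left (abs_exp_sub_one_le_mul_exp _) (Real.exp_pos _).le

/-- Domination of normalised differences of `exp (-t f)` along `t → 0`, `t f x → ∞`. -/
lemma exists_exp_increment_bound (hf : Continuous f) (hf0 : ∀ x, 0 ≤ f x)
    (hfg : ∀ h, Tendsto (fun x => (f (x + h) - f x) / g x) atTop (𝓝 h))
    (hg : ∀ h, Tendsto (fun x => g (x + h) / g x) atTop (𝓝 1))
    (hg0 : ∀ᶠ x in atTop, 0 ≤ g x) {M : ℝ} (hM : ∀ᶠ x in atTop, g x ≤ M)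
    {ι : Type*} {l : Filter ι} {t x : ι → ℝ} (ht : Tendsto t l (𝓝[>] 0)) (hx : Tendsto x l atTop)
    (htf : Tendsto (fun i => t i * f (x i)) l atTop) :
    ∃ C ≥ 0, ∀ᶠ i in l, ∀ h,
      |(Real.exp (-(t i * f (x i + h))) - Real.exp (-(t i * f (x i)))) /
        (t i * g (x i) * Real.exp (-(t i * f (x i))))| ≤ C * Real.exp (|h| / 2) := by
  -- The exponent 1/8 leaves room: at most three factors exp(|h|/8) get multiplied below, and 3/8 ≤
  -- 1/2.
  obtain ⟨C₁, hC₁, X₁, h₁⟩ := exists_potter_bound hf hfg hg hg0 (δ := 1 / 8) (by norm_num)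
  obtain ⟨C₂, hC₂, X₂, h₂⟩ := exists_linear_increment_bound hf hfg hg hg0 hM
  set X₀ := max X₁ X₂
  set A := f X₀ + 2 * C₂ with hA
  have hA0 : 0 ≤ A := add_nonneg (hf0 _) (by positivity)
  have hpos : ∀ᶠ i in l, 0 < t i := (tendsto_nhdsWithin_iff.1 ht).2
  have ht0 : Tendsto t l (𝓝 0) := (tendsto_nhdsWithin_iff.1 ht).1
  set C := C₁ * Real.exp 1 + Real.exp 1 * C₁ * (A + 8 * C₂) with hC
  refine ⟨C, by positivity, ?_⟩
  have hsm : ∀ B : ℝ, ∀ b > 0, ∀ᶠ i in l, t i * B ≤ b := fun B b hb =>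
    (by simpa using ht0.mul_const B : Tendsto (fun i => t i * B) l (𝓝 0)).eventually_le_const hb
  filter_upwards [hpos, hsm C₂ (1 / 8) (by norm_num), hsm A 1 one_pos,
    hsm (f X₀ + 1) (1 / 2) (by norm_num), hx.eventually_ge_atTop X₀,
    htf.eventually_ge_atTop 1] with i ti htC htA htX hxi hti h
  set T := t i
  set y := x i
  have hy1 : X₁ ≤ y := (le_max_left _ _).trans hxi
  have hy2 : X₂ ≤ y := (le_max_right _ _).trans hxi
  have hgy : 0 < g y := (h₁ y hy1 y hy1).1
  have hW : 0 < T * g y * Real.exp (-(T * f y)) := by positivity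
  rw [abs_div, abs_of_pos hW, div_le_iff₀ hW]
  rcases le_total X₀ (y + h) with hh | hh
  · have e1 := (h₁ y hy1 (y + h) ((le_max_left _ _).trans hh)).2
    have e2 := h₂ y hy2 (y + h) ((le_max_right _ _).trans hh)
    rw [add_sub_cancel_left] at e1 e2
    refine (abs_exp_neg_sub_exp_neg_le _ _).trans ?_
    rw [← mul_sub, abs_mul, abs_of_pos ti]
    have e3 : T * |f (y + h) - f y| ≤ |h| / 8 + 1 := by
      have := mul_le_mul_of_nonneg_left e2 ti.le
      have := mul_le_mul_of_nonneg_right htC (by positivity : 0 ≤ |h| + 2)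
      nlinarith
    calc Real.exp (-(T * f y)) * (T * |f (y + h) - f y| * Real.exp (T * |f (y + h) - f y|))
        ≤ Real.exp (-(T * f y)) * (T * (C₁ * Real.exp (1 / 8 * |h|) * g y) *
            Real.exp (|h| / 8 + 1)) := by gcongr
      _ = C₁ * Real.exp 1 * (Real.exp (1 / 8 * |h|) * Real.exp (|h| / 8)) *
            (T * g y * Real.exp (-(T * f y))) := by rw [Real.exp_add]; ring
      _ = C₁ * Real.exp 1 * Real.exp (|h| / 4) * (T * g y * Real.exp (-(T * f y))) := by
          rw [← Real.exp_add]; ring_nf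
      _ ≤ C * Real.exp (|h| / 2) * (T * g y * Real.exp (-(T * f y))) := by
          gcongr
          · rw [hC]; exact le_add_of_nonneg_right (by positivity)
          · norm_num
  -- Here y + h has fallen below X₀, so only the trivial bound 1 on the numerator is available.
  -- Since z ≤ |h|, it suffices that each of the factors g(y), T and exp(-T f(y)) of the denominator
  -- is at least a constant times exp(-z/8).
  · set z := y - X₀ with hz
    have hz0 : 0 ≤ z := by linarith
    have hzh : z ≤ |h| := by have := neg_abs_le h; linarith
    have e1 := (h₁ y hy1 X₀ (le_max_left _ _)).2
    have e2 := h₂ X₀ (le_max_right _ _) y hy2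
    rw [abs_sub_comm X₀ y, abs_of_nonneg (by linarith : 0 ≤ y - X₀), ← hz] at e1
    rw [abs_of_nonneg (by linarith : 0 ≤ y - X₀), ← hz] at e2
    -- T f(y) ≥ 1 while T (f X₀ + 1) ≤ 1/2; the resulting unit gap is what bounds g(y) below through
    -- the Potter estimate.
    have e3 : 1 ≤ f y - f X₀ := by
      by_contra hcon
      have := mul_le_mul_of_nonneg_left (by linarith : f y ≤ f X₀ + 1) ti.le
      linarith
    have e4 : 1 ≤ C₁ * Real.exp (1 / 8 * z) * g y := by
      rw [abs_sub_comm] at e1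
      exact e3.trans ((le_abs_self _).trans e1)
    have e5 : f y ≤ A + C₂ * z := by
      have := (le_abs_self _).trans e2
      rw [hA]; linarith
    have e6 : 1 ≤ T * (A + C₂ * z) := hti.trans (mul_le_mul_of_nonneg_left e5 ti.le)
    have e7 : A + C₂ * z ≤ (A + 8 * C₂) * Real.exp (1 / 8 * z) := by
      have := Real.add_one_le_exp (1 / 8 * z)
      have := mul_le_mul_of_nonneg_left this (by positivity : 0 ≤ A + 8 * C₂)
      have : 0 ≤ A * z := by positivity
      nlinarith
    have e8 : 1 ≤ Real.exp 1 * Real.exp (1 / 8 * z) * Real.exp (-(T * f y)) := by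
      rw [← Real.exp_add, ← Real.exp_add]
      refine Real.one_le_exp ?_
      have := mul_le_mul_of_nonneg_left e5 ti.le
      have := mul_le_mul_of_nonneg_right htC hz0
      nlinarith
    have e9 : |Real.exp (-(T * f (y + h))) - Real.exp (-(T * f y))| ≤ 1 := by
      have a1 : Real.exp (-(T * f (y + h))) ≤ 1 :=
        Real.exp_le_one_iff.2 (neg_nonpos.2 (mul_nonneg ti.le (hf0 _)))
      have a2 : Real.exp (-(T * f y)) ≤ 1 :=
        Real.exp_le_one_iff.2 (neg_nonpos.2 (mul_nonneg ti.le (hf0 _)))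
      have a3 := Real.exp_pos (-(T * f (y + h)))
      have a4 := Real.exp_pos (-(T * f y))
      rw [abs_le]; constructor <;> linarith
    have hprod : 1 ≤ (C₁ * Real.exp (1 / 8 * z) * g y) *
        (T * ((A + 8 * C₂) * Real.exp (1 / 8 * z))) *
        (Real.exp 1 * Real.exp (1 / 8 * z) * Real.exp (-(T * f y))) :=
      one_le_mul_of_one_le_of_one_le (one_le_mul_of_one_le_of_one_le e4
        (e6.trans (mul_le_mul_of_nonneg_left e7 ti.le))) e8
    refine e9.trans (hprod.trans ?_)
    calc _ = Real.exp 1 * C₁ * (A + 8 * C₂) *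
          (Real.exp (1 / 8 * z) * Real.exp (1 / 8 * z) * Real.exp (1 / 8 * z)) *
          (T * g y * Real.exp (-(T * f y))) := by ring
      _ = Real.exp 1 * C₁ * (A + 8 * C₂) * Real.exp (3 * z / 8) *
          (T * g y * Real.exp (-(T * f y))) := by
          rw [← Real.exp_add, ← Real.exp_add]; ring_nf
      _ ≤ C * Real.exp (|h| / 2) * (T * g y * Real.exp (-(T * f y))) := by
          have h1 : 3 * z / 8 ≤ |h| / 2 := by linarith
          gcongr ?_ * Real.exp ?_ * _
          rw [hC]; exact le_add_of_nonneg_left (by positivity)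

/-- First-order expansion of exp: boundedness of g and t → 0 give t g(x) → 0, so the exponent
t(f(x+h) - f(x)), which is t g(x) times a quantity tending to h, tends to 0. -/
lemma tendsto_exp_increment
    (hfg : ∀ h, Tendsto (fun x => (f (x + h) - f x) / g x) atTop (𝓝 h))
    (hg : ∀ h, Tendsto (fun x => g (x + h) / g x) atTop (𝓝 1))
    (hg0 : ∀ᶠ x in atTop, 0 ≤ g x) {M : ℝ} (hM : ∀ᶠ x in atTop, g x ≤ M)
    {ι : Type*} {l : Filter ι} {t x : ι → ℝ} (ht : Tendsto t l (𝓝[>] 0)) (hx : Tendsto x l atTop)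
    (h : ℝ) :
    Tendsto (fun i => (Real.exp (-(t i * f (x i + h))) - Real.exp (-(t i * f (x i)))) /
        (t i * g (x i) * Real.exp (-(t i * f (x i))))) l (𝓝 (-h)) := by
  have hpos : ∀ᶠ i in l, 0 < t i := (tendsto_nhdsWithin_iff.1 ht).2
  have ht0 : Tendsto t l (𝓝 0) := (tendsto_nhdsWithin_iff.1 ht).1
  have hgx := hx.eventually (eventually_pos_of_tendsto_ratio hg hg0)
  have hε : Tendsto (fun i => t i * g (x i)) l (𝓝 0) := by
    refine squeeze_zero' ((hpos.and hgx).mono fun i hi => (mul_pos hi.1 hi.2).le)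
      (g := fun i => t i * M) ?_ (by simpa using ht0.mul_const M)
    filter_upwards [hpos, hx.eventually hM] with i h1 h2
    exact mul_le_mul_of_nonneg_left h2 h1.le
  have hA := (hfg h).comp hx
  have hz : Tendsto (fun i => -(t i * g (x i) * ((f (x i + h) - f (x i)) / g (x i)))) l (𝓝 0) := by
    simpa using (hε.mul hA).neg
  -- `exp z - 1 = z * dslope exp 0 z`, with `dslope exp 0` continuous at `0`
  have hs : Tendsto (fun z => dslope Real.exp 0 z) (𝓝 0) (𝓝 1) := by
    have : ContinuousAt (dslope Real.exp 0) 0 :=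
      continuousAt_dslope_same.2 Real.differentiableAt_exp
    simpa [ContinuousAt, dslope_same] using this
  have key := (hA.neg).mul (hs.comp hz)
  simp only [mul_one] at key
  refine key.congr' ?_
  filter_upwards [hpos, hgx] with i h1 h2
  have hslope : ∀ z : ℝ, z * dslope Real.exp 0 z = Real.exp z - 1 := fun z => by
    simpa using sub_smul_dslope Real.exp 0 z
  have e1 := hslope (-(t i * g (x i) * ((f (x i + h) - f (x i)) / g (x i))))
  have e2 : -(t i * g (x i) * ((f (x i + h) - f (x i)) / g (x i))) =
      t i * f (x i) - t i * f (x i + h) := by field_simp; ring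
  have e3 : Real.exp (-(t i * f (x i + h))) =
      Real.exp (-(t i * f (x i))) * Real.exp (t i * f (x i) - t i * f (x i + h)) := by
    rw [← Real.exp_add]; ring_nf
  simp only [Function.comp]
  rw [e3, ← e2, show ∀ a b : ℝ, a * b - a = a * (b - 1) by intros; ring, ← e1]
  have := Real.exp_pos (-(t i * f (x i)))
  field_simp

end DeHaan

/-! ### Gaussian averages of the characteristic function. -/

section Gaussian

variable {d : ℕ}

/-- The Gaussian transform of a measure in terms of its radial characteristic function. -/
lemma integral_exp_neg_mul_sq_eq_of_charFun (μ : Measure (EuclideanSpace ℝ (Fin d)))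
    [IsProbabilityMeasure μ] {φ : ℝ → ℝ} (hφ : ∀ ξ, charFun μ ξ = (φ ‖ξ‖ : ℂ)) {b : ℝ}
    (hb : 0 ≤ b) :
    ∫ v : EuclideanSpace ℝ (Fin d), Real.exp (-‖v‖ ^ 2) * φ (2 * b * ‖v‖) =
      Real.pi ^ ((d : ℝ) / 2) * ∫ y, Real.exp (-(b * ‖y‖) ^ 2) ∂μ := by
  rw [← Complex.ofReal_inj, Complex.ofReal_mul, ← integral_complex_ofReal,
    ← integral_complex_ofReal]
  have h1 : ∀ v : EuclideanSpace ℝ (Fin d),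
      ((Real.exp (-‖v‖ ^ 2) * φ (2 * b * ‖v‖) : ℝ) : ℂ) =
      ∫ y, Complex.exp (-(1 : ℂ) * ‖v‖ ^ 2 + 2 * b * Complex.I * (inner ℝ y v : ℝ)) ∂μ := by
    intro v
    have h2 := hφ ((2 * b) • v)
    rw [norm_smul, Real.norm_of_nonneg (by positivity)] at h2
    rw [Complex.ofReal_mul, ← h2, charFun_apply, ← integral_const_mul]
    refine integral_congr_ae (.of_forall fun y => ?_)
    simp only
    rw [Complex.ofReal_exp, ← Complex.exp_add, inner_smul_right]
    congr 1
    push_cast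
    ring
  simp_rw [h1]
  rw [integral_integral_swap, ← integral_const_mul]
  · refine integral_congr_ae (.of_forall fun y => ?_)
    simp only
    rw [GaussianFourier.integral_cexp_neg_mul_sq_norm_add (by simp)]
    rw [Complex.ofReal_cpow Real.pi_pos.le, Complex.ofReal_exp, finrank_euclideanSpace_fin]
    congr 1
    · simp
    · congr 1
      push_cast
      rw [mul_pow, Complex.I_sq]
      ring
  · have hg : Integrable (fun v : EuclideanSpace ℝ (Fin d) => Real.exp (-1 * ‖v‖ ^ 2)) := by
      have := GaussianFourier.integrable_cexp_neg_mul_sq_norm_add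
        (V := EuclideanSpace ℝ (Fin d)) (b := 1) (by simp) 0 0
      refine this.norm.congr (.of_forall fun v => ?_)
      simp only [Complex.norm_exp]
      congr 1
      simp [← Complex.ofReal_pow]
    refine (hg.mul_prod (integrable_const (1 : ℝ) (μ := μ))).mono' ?_ (.of_forall fun z => ?_)
    · exact Continuous.aestronglyMeasurable (by fun_prop)
    · simp only [Function.uncurry, Complex.norm_exp]
      rw [mul_one]
      refine le_of_eq (congrArg _ ?_)
      simp [← Complex.ofReal_pow]

/-- In polar coordinates the radial exponent is d - 1 + a > -1. Used with a = ±1/2 for the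
dominating function. -/
lemma integrable_exp_neg_sq_mul_rpow (hd : 1 ≤ d) {c a : ℝ} (hc : 0 ≤ c) (ha : -1 < a) :
    Integrable (fun v : EuclideanSpace ℝ (Fin d) => Real.exp (-‖v‖ ^ 2) * (c * ‖v‖) ^ a) := by
  have : Nonempty (Fin d) := ⟨⟨0, hd⟩⟩
  have : Nontrivial (EuclideanSpace ℝ (Fin d)) :=
    Module.nontrivial_of_finrank_pos (R := ℝ) (by simpa using Nat.pos_of_ne_zero (by omega))
  refine (integrable_fun_norm_addHaar volume
    (f := fun ρ => Real.exp (-ρ ^ 2) * (c * ρ) ^ a)).2 ?_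
  have hd' : (1 : ℝ) ≤ d := by exact_mod_cast hd
  have := (integrableOn_rpow_mul_exp_neg_mul_sq one_pos
    (s := (d : ℝ) - 1 + a) (by linarith)).const_mul (c ^ a)
  refine this.congr ((ae_restrict_iff' measurableSet_Ioi).2 (.of_forall fun ρ hρ => ?_))
  have hρ : 0 < ρ := hρ
  simp only [finrank_euclideanSpace_fin, smul_eq_mul]
  rw [Real.rpow_add hρ, Real.mul_rpow hc hρ.le, ← Real.rpow_natCast ρ (d - 1),
    Nat.cast_sub hd]
  push_cast
  rw [neg_one_mul]
  ring

/-- Turns the bound exp(|h|/2) with h = log u into powers of u that are integrable against a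
Gaussian. -/
lemma exp_abs_log_div_two_le {u : ℝ} (hu : 0 < u) :
    Real.exp (|Real.log u| / 2) ≤ u ^ (1 / 2 : ℝ) + u ^ (-1 / 2 : ℝ) := by
  rw [Real.rpow_def_of_pos hu, Real.rpow_def_of_pos hu]
  rcases abs_cases (Real.log u) with ⟨h, -⟩ | ⟨h, -⟩ <;> rw [h]
  · refine le_add_of_le_of_nonneg (le_of_eq (congrArg _ (by ring))) (Real.exp_pos _).le
  · refine le_add_of_nonneg_of_le (Real.exp_pos _).le (le_of_eq (congrArg _ (by ring)))

/-- Asymptotics of Gaussian transforms of measures with characteristic functions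
`exp (-t ψ(‖ξ‖))`, for `ψ` in the de Haan class of `ℓ`. -/
lemma tendsto_gaussian_transform (hd : 1 ≤ d) {ψ ℓ : ℝ → ℝ} (hψc : ContinuousOn ψ (Set.Ici 0))
    (hψ0 : ∀ r, 0 ≤ r → 0 ≤ ψ r)
    (hψℓ : ∀ c, 0 < c → Tendsto (fun x => (ψ (c * x) - ψ x) / ℓ x) atTop (𝓝 (Real.log c)))
    (hℓ : ∀ c, 0 < c → Tendsto (fun x => ℓ (c * x) / ℓ x) atTop (𝓝 1))
    (hℓ0 : ∀ᶠ x in atTop, 0 ≤ ℓ x) {M : ℝ} (hM : ∀ᶠ x in atTop, ℓ x ≤ M)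
    {ι : Type*} {l : Filter ι} [l.IsCountablyGenerated] {t r : ι → ℝ}
    (ht : Tendsto t l (𝓝[>] 0)) (hr : Tendsto r l atTop)
    (htψ : Tendsto (fun i => t i * ψ (r i)) l atTop)
    (μ : ι → Measure (EuclideanSpace ℝ (Fin d))) [∀ i, IsProbabilityMeasure (μ i)]
    (hμ : ∀ i ξ, charFun (μ i) ξ = (Real.exp (-(t i * ψ ‖ξ‖)) : ℂ)) {b c : ℝ} (hb : 0 < b)
    (hc : 0 < c) :
    Tendsto (fun i => ((∫ y, Real.exp (-(b * (r i * ‖y‖)) ^ 2) ∂μ i) -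
        ∫ y, Real.exp (-(c * (r i * ‖y‖)) ^ 2) ∂μ i) /
        (t i * ℓ (r i) * Real.exp (-(t i * ψ (r i))))) l (𝓝 (Real.log (c / b))) := by
  -- Logarithmic coordinates make the multiplicative increments of ψ and ℓ additive.
  set f : ℝ → ℝ := fun x => ψ (Real.exp x)
  set g : ℝ → ℝ := fun x => ℓ (Real.exp x)
  have hf : Continuous f := hψc.comp_continuous Real.continuous_exp fun x => (Real.exp_pos x).le
  have hf0 : ∀ x, 0 ≤ f x := fun x => hψ0 _ (Real.exp_pos x).le
  have hfg : ∀ h, Tendsto (fun x => (f (x + h) - f x) / g x) atTop (𝓝 h) := fun h => by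
    have := (hψℓ _ (Real.exp_pos h)).comp Real.tendsto_exp_atTop
    rw [Real.log_exp] at this
    refine this.congr fun x => ?_
    simp [f, g, Real.exp_add, mul_comm]
  have hg : ∀ h, Tendsto (fun x => g (x + h) / g x) atTop (𝓝 1) := fun h => by
    refine ((hℓ _ (Real.exp_pos h)).comp Real.tendsto_exp_atTop).congr fun x => ?_
    simp [g, Real.exp_add, mul_comm]
  have hg0 : ∀ᶠ x in atTop, 0 ≤ g x := Real.tendsto_exp_atTop.eventually hℓ0
  have hgM : ∀ᶠ x in atTop, g x ≤ M := Real.tendsto_exp_atTop.eventually hM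
  have hx : Tendsto (fun i => Real.log (r i)) l atTop := Real.tendsto_log_atTop.comp hr
  have hrpos := hr.eventually_gt_atTop 0
  have htf : Tendsto (fun i => t i * f (Real.log (r i))) l atTop := by
    refine htψ.congr' (hrpos.mono fun i hi => ?_)
    simp only [f]; rw [Real.exp_log hi]
  obtain ⟨C, hC, hbound⟩ := exists_exp_increment_bound hf hf0 hfg hg hg0 hgM ht hx htf
  -- the normalised difference of characteristic functions
  let D : ι → ℝ → ℝ := fun i u => (Real.exp (-(t i * ψ (r i * u))) -
    Real.exp (-(t i * ψ (r i)))) / (t i * ℓ (r i) * Real.exp (-(t i * ψ (r i))))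
  have hD : ∀ i u, 0 < r i → 0 < u → D i u =
      (Real.exp (-(t i * f (Real.log (r i) + Real.log u))) -
        Real.exp (-(t i * f (Real.log (r i))))) /
        (t i * g (Real.log (r i)) * Real.exp (-(t i * f (Real.log (r i))))) := by
    intro i u hi hu
    simp only [D, f, g]
    rw [Real.exp_add, Real.exp_log hi, Real.exp_log hu]
  have hcont : ∀ (i : ι) (k : ℝ), 0 ≤ k → 0 ≤ r i →
      Continuous fun v : EuclideanSpace ℝ (Fin d) =>
        Real.exp (-(t i * ψ (r i * (2 * k * ‖v‖)))) := by
    intro i k hk hi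
    have : Continuous fun v : EuclideanSpace ℝ (Fin d) => ψ (r i * (2 * k * ‖v‖)) :=
      hψc.comp_continuous (by fun_prop) fun v => by simp only [Set.mem_Ici]; positivity
    exact Real.continuous_exp.comp (this.const_mul _).neg
  have hcexp : Continuous fun v : EuclideanSpace ℝ (Fin d) => Real.exp (-‖v‖ ^ 2) := by fun_prop
  have hgauss : Integrable (fun v : EuclideanSpace ℝ (Fin d) => Real.exp (-‖v‖ ^ 2)) := by
    simpa using integrable_exp_neg_sq_mul_rpow hd (c := 1) zero_le_one (a := 0) (by norm_num)
  have hmass : ∫ v : EuclideanSpace ℝ (Fin d), Real.exp (-‖v‖ ^ 2) =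
      Real.pi ^ ((d : ℝ) / 2) := by
    have := GaussianFourier.integral_rexp_neg_mul_sq_norm (V := EuclideanSpace ℝ (Fin d)) one_pos
    simpa using this
  have hnull : ∀ᵐ v : EuclideanSpace ℝ (Fin d), v ≠ 0 := by
    have : Nontrivial (EuclideanSpace ℝ (Fin d)) :=
      Module.nontrivial_of_finrank_pos (R := ℝ) (by simpa using Nat.pos_of_ne_zero (by omega))
    simp [ae_iff]
  let B : ℝ → EuclideanSpace ℝ (Fin d) → ℝ := fun k v =>
    C * (Real.exp (-‖v‖ ^ 2) * (2 * k * ‖v‖) ^ (1 / 2 : ℝ) +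
      Real.exp (-‖v‖ ^ 2) * (2 * k * ‖v‖) ^ (-1 / 2 : ℝ))
  have hB : ∀ k, 0 < k → Integrable (B k) := fun k hk =>
    ((integrable_exp_neg_sq_mul_rpow hd (by positivity) (by norm_num)).add
      (integrable_exp_neg_sq_mul_rpow hd (by positivity) (by norm_num))).const_mul C
  have hDB : ∀ k, 0 < k → ∀ᶠ i in l, ∀ v : EuclideanSpace ℝ (Fin d), v ≠ 0 →
      |Real.exp (-‖v‖ ^ 2) * D i (2 * k * ‖v‖)| ≤ B k v := by
    intro k hk
    filter_upwards [hbound, hrpos] with i hi hri v hv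
    have hv' : 0 < ‖v‖ := norm_pos_iff.2 hv
    have hu : 0 < 2 * k * ‖v‖ := by positivity
    rw [abs_mul, abs_of_pos (Real.exp_pos _), hD i _ hri hu]
    calc _ ≤ Real.exp (-‖v‖ ^ 2) * (C * ((2 * k * ‖v‖) ^ (1 / 2 : ℝ) +
          (2 * k * ‖v‖) ^ (-1 / 2 : ℝ))) := by
          gcongr
          exact (hi _).trans (mul_le_mul_of_nonneg_left (exp_abs_log_div_two_le hu) hC)
      _ = B k v := by simp only [B]; ring
  -- Subtracting the two scales removes the common reference value exp(-tψ(r)), and the pointwise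
  -- limits -log(2b|v|) and -log(2c|v|) differ by log(c/b), independent of v.
  have key : Tendsto (fun i => ∫ v : EuclideanSpace ℝ (Fin d),
      (Real.exp (-‖v‖ ^ 2) * D i (2 * b * ‖v‖) - Real.exp (-‖v‖ ^ 2) * D i (2 * c * ‖v‖))) l
      (𝓝 (∫ v : EuclideanSpace ℝ (Fin d), Real.exp (-‖v‖ ^ 2) * Real.log (c / b))) := by
    refine tendsto_integral_filter_of_dominated_convergence (fun v => B b v + B c v) ?_ ?_
      ((hB b hb).add (hB c hc)) ?_
    · filter_upwards [hrpos] with i hi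
      have h1 := hcont i b hb.le hi.le
      have h2 := hcont i c hc.le hi.le
      simp only [D]
      exact ((hcexp.mul ((h1.sub continuous_const).div_const _)).sub
        (hcexp.mul ((h2.sub continuous_const).div_const _))).aestronglyMeasurable
    · filter_upwards [hDB b hb, hDB c hc] with i h1 h2
      filter_upwards [hnull] with v hv
      exact (abs_sub _ _).trans (add_le_add (h1 v hv) (h2 v hv))
    · filter_upwards [hnull] with v hv
      have hv' : 0 < ‖v‖ := norm_pos_iff.2 hv
      have hlim : ∀ k, 0 < k → Tendsto (fun i => D i (2 * k * ‖v‖)) l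
          (𝓝 (-Real.log (2 * k * ‖v‖))) := fun k hk =>
        (tendsto_exp_increment hfg hg hg0 hgM ht hx (Real.log (2 * k * ‖v‖))).congr'
          (hrpos.mono fun i hi => (hD i _ hi (by positivity)).symm)
      have := ((hlim b hb).const_mul (Real.exp (-‖v‖ ^ 2))).sub
        ((hlim c hc).const_mul (Real.exp (-‖v‖ ^ 2)))
      convert this using 2
      rw [Real.log_div hc.ne' hb.ne', Real.log_mul (by positivity) hv'.ne',
        Real.log_mul (by positivity) hv'.ne', Real.log_mul two_ne_zero hb.ne',
        Real.log_mul two_ne_zero hc.ne']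
      ring
  rw [integral_mul_const, hmass] at key
  have hpi : Real.pi ^ ((d : ℝ) / 2) ≠ 0 := (Real.rpow_pos_of_pos Real.pi_pos _).ne'
  have key2 := key.const_mul (Real.pi ^ ((d : ℝ) / 2))⁻¹
  rw [inv_mul_cancel_left₀ hpi] at key2
  refine key2.congr' ?_
  filter_upwards [hrpos, (tendsto_nhdsWithin_iff.1 ht).2] with i hi hti
  have hti : 0 < t i := hti
  have hint : ∀ k, 0 < k → Integrable (fun v : EuclideanSpace ℝ (Fin d) =>
      Real.exp (-‖v‖ ^ 2) * Real.exp (-(t i * ψ (r i * (2 * k * ‖v‖))))) := by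
    intro k hk
    have h1 := hcont i k hk.le hi.le
    refine hgauss.mono' (hcexp.mul h1).aestronglyMeasurable (.of_forall fun v => ?_)
    rw [norm_mul, Real.norm_of_nonneg (Real.exp_pos _).le, Real.norm_of_nonneg (Real.exp_pos _).le]
    refine mul_le_of_le_one_right (Real.exp_pos _).le (Real.exp_le_one_iff.2 ?_)
    rw [neg_nonpos]
    exact mul_nonneg hti.le (hψ0 _ (by positivity))
  have htrans : ∀ k, 0 < k → ∫ v : EuclideanSpace ℝ (Fin d),
      Real.exp (-‖v‖ ^ 2) * Real.exp (-(t i * ψ (r i * (2 * k * ‖v‖)))) =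
      Real.pi ^ ((d : ℝ) / 2) * ∫ y, Real.exp (-(k * (r i * ‖y‖)) ^ 2) ∂μ i := by
    intro k hk
    have := integral_exp_neg_mul_sq_eq_of_charFun (μ i)
      (φ := fun u => Real.exp (-(t i * ψ u))) (fun ξ => hμ i ξ) (b := k * r i) (by positivity)
    rw [show (fun y : EuclideanSpace ℝ (Fin d) => Real.exp (-(k * (r i * ‖y‖)) ^ 2)) =
      fun y => Real.exp (-(k * r i * ‖y‖) ^ 2) by ext y; ring_nf, ← this]
    refine integral_congr_ae (.of_forall fun v => ?_)
    simp only
    rw [show r i * (2 * k * ‖v‖) = 2 * (k * r i) * ‖v‖ by ring]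
  have hrw : ∀ v : EuclideanSpace ℝ (Fin d),
      Real.exp (-‖v‖ ^ 2) * D i (2 * b * ‖v‖) - Real.exp (-‖v‖ ^ 2) * D i (2 * c * ‖v‖) =
      (Real.exp (-‖v‖ ^ 2) * Real.exp (-(t i * ψ (r i * (2 * b * ‖v‖)))) -
        Real.exp (-‖v‖ ^ 2) * Real.exp (-(t i * ψ (r i * (2 * c * ‖v‖))))) /
        (t i * ℓ (r i) * Real.exp (-(t i * ψ (r i)))) := by
    intro v; simp only [D]; ring
  simp_rw [hrw]
  rw [integral_div, integral_sub (hint b hb) (hint c hc), htrans b hb, htrans c hc, ← mul_sub,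
    mul_div_assoc, inv_mul_cancel_left₀ hpi]

end Gaussian

/-! ### From moments to continuous test functions. -/

section Moments

/-- Convergence of moments of weighted measures on `[0, 1]` implies weak convergence. -/
lemma tendsto_integral_comp_of_moments {α ι : Type*} [MeasurableSpace α] {l : Filter ι}
    {μ : ι → Measure α} {u m : ι → α → ℝ} {μ' : Measure α} {u' m' : α → ℝ}
    (hu : ∀ i, Measurable (u i)) (hu01 : ∀ i a, u i a ∈ Set.Icc (0 : ℝ) 1)
    (hm : ∀ i, Integrable (m i) (μ i)) (hm0 : ∀ᶠ i in l, ∀ a, 0 ≤ m i a)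
    (hu' : Measurable u') (hu01' : ∀ a, u' a ∈ Set.Icc (0 : ℝ) 1)
    (hm' : Integrable m' μ') (hm0' : ∀ a, 0 ≤ m' a)
    (hmom : ∀ n : ℕ, Tendsto (fun i => ∫ a, u i a ^ n * m i a ∂μ i) l
      (𝓝 (∫ a, u' a ^ n * m' a ∂μ')))
    {h : ℝ → ℝ} (hh : Continuous h) :
    Tendsto (fun i => ∫ a, h (u i a) * m i a ∂μ i) l (𝓝 (∫ a, h (u' a) * m' a ∂μ')) := by
  have hint : ∀ {ν : Measure α} {v n : α → ℝ}, Measurable v → (∀ a, v a ∈ Set.Icc (0 : ℝ) 1) →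
      Integrable n ν → ∀ {k : ℝ → ℝ}, Continuous k → Integrable (fun a => k (v a) * n a) ν := by
    intro ν v n hv hv01 hn k hk
    obtain ⟨C, hC⟩ := isCompact_Icc.exists_bound_of_continuousOn (s := Set.Icc (0 : ℝ) 1)
      hk.continuousOn
    exact hn.bdd_mul (c := C) (hk.measurable.comp hv).aestronglyMeasurable
      (.of_forall fun a => hC _ (hv01 a))
  have hpoly : ∀ p : Polynomial ℝ, Tendsto (fun i => ∫ a, p.eval (u i a) * m i a ∂μ i) l
      (𝓝 (∫ a, p.eval (u' a) * m' a ∂μ')) := by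
    intro p
    have hexp : ∀ {ν : Measure α} {v n : α → ℝ}, Measurable v → (∀ a, v a ∈ Set.Icc (0 : ℝ) 1) →
        Integrable n ν → ∫ a, p.eval (v a) * n a ∂ν =
          ∑ j ∈ Finset.range (p.natDegree + 1), p.coeff j * ∫ a, v a ^ j * n a ∂ν := by
      intro ν v n hv hv01 hn
      simp_rw [Polynomial.eval_eq_sum_range, Finset.sum_mul, mul_assoc]
      rw [integral_finsetSum]
      · simp_rw [integral_const_mul]
      · exact fun j _ => (hint hv hv01 hn (continuous_pow j)).const_mul _
    rw [hexp hu' hu01' hm']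
    simp_rw [fun i => hexp (hu i) (hu01 i) (hm i)]
    exact tendsto_finsetSum _ fun j _ => (hmom j).const_mul _
  have hclose : ∀ {ν : Measure α} {v n : α → ℝ}, Measurable v → (∀ a, v a ∈ Set.Icc (0 : ℝ) 1) →
      Integrable n ν → (∀ a, 0 ≤ n a) → ∀ {p : Polynomial ℝ} {η : ℝ},
      (∀ x ∈ Set.Icc (0 : ℝ) 1, |p.eval x - h x| < η) →
      |∫ a, h (v a) * n a ∂ν - ∫ a, p.eval (v a) * n a ∂ν| ≤ η * ∫ a, n a ∂ν := by
    intro ν v n hv hv01 hn hn0 p η hp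
    rw [← integral_sub (hint hv hv01 hn hh) (hint hv hv01 hn p.continuous), ← integral_const_mul]
    rw [← Real.norm_eq_abs]
    refine norm_integral_le_of_norm_le (hn.const_mul η) (.of_forall fun a => ?_)
    rw [← sub_mul, norm_mul, Real.norm_of_nonneg (hn0 a), Real.norm_eq_abs, abs_sub_comm]
    exact mul_le_mul_of_nonneg_right (hp _ (hv01 a)).le (hn0 a)
  have hmass : Tendsto (fun i => ∫ a, m i a ∂μ i) l (𝓝 (∫ a, m' a ∂μ')) := by
    simpa using hmom 0
  -- The zeroth moment bounds all masses by B eventually, so a polynomial within ε/(4B) of h costs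
  -- ε/4 on each side, and its own convergence another ε/4.
  set B := ∫ a, m' a ∂μ' + 1
  have hI : 0 ≤ ∫ a, m' a ∂μ' := integral_nonneg hm0'
  have hB : 0 < B := by positivity
  rw [Metric.tendsto_nhds]
  intro ε hε
  obtain ⟨p, hp⟩ := exists_polynomial_near_of_continuousOn 0 1 h hh.continuousOn (ε / (4 * B))
    (by positivity)
  filter_upwards [hm0, hmass.eventually_lt_const (lt_add_one (∫ a, m' a ∂μ')),
    (Metric.tendsto_nhds.1 (hpoly p)) (ε / 4) (by positivity)] with i h0 h1 h2
  have e1 := hclose (hu i) (hu01 i) (hm i) h0 hp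
  have e2 := hclose hu' hu01' hm' hm0' hp
  have e3 : ∀ z, z ≤ B → ε / (4 * B) * z ≤ ε / 4 := fun z hz => by
    calc ε / (4 * B) * z ≤ ε / (4 * B) * B := by gcongr
      _ = ε / 4 := by field_simp
  have e4 := e1.trans (e3 _ h1.le)
  have e5 := e2.trans (e3 _ (lt_add_one _).le)
  rw [Real.dist_eq] at h2 ⊢
  rw [abs_le] at e4 e5
  rw [abs_lt] at h2 ⊢
  constructor <;> linarith [h2.1, h2.2, e4.1, e4.2, e5.1, e5.2]

end Moments

/-! ### The limit measure: Gaussian differences against |y|^{-d} dy. -/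

section Frullani

lemma abs_exp_neg_sub_exp_neg_le_add (α β : ℝ) :
    |Real.exp (-α) - Real.exp (-β)| ≤ |α - β| * (Real.exp (-α) + Real.exp (-β)) := by
  wlog h : α ≤ β generalizing α β
  · rw [abs_sub_comm, abs_sub_comm α, add_comm]
    exact this β α (le_of_not_ge h)
  have h1 := Real.add_one_le_exp (-(β - α))
  have h2 : Real.exp (-β) = Real.exp (-α) * Real.exp (-(β - α)) := by
    rw [← Real.exp_add]; ring_nf
  have h3 := Real.exp_pos (-α)
  have h4 := Real.exp_pos (-β)
  rw [abs_of_nonneg (sub_nonneg.2 (Real.exp_le_exp.2 (by linarith))), abs_of_nonpos (by linarith)]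
  nlinarith

/-- The difference is at most |b² - c²|ρ² times a sum of Gaussians, so dividing by ρ still leaves ρ
times Gaussians. -/
lemma integrableOn_inv_mul_exp_sub_exp {b c : ℝ} (hb : 0 < b) (hc : 0 < c) :
    IntegrableOn (fun ρ : ℝ => ρ⁻¹ • (Real.exp (-(b * ρ) ^ 2) - Real.exp (-(c * ρ) ^ 2)))
      (Set.Ioi 0) := by
  have h1 : Integrable (fun ρ : ℝ => |b ^ 2 - c ^ 2| *
      (ρ * Real.exp (-(b ^ 2) * ρ ^ 2) + ρ * Real.exp (-(c ^ 2) * ρ ^ 2))) :=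
    ((integrable_mul_exp_neg_mul_sq (by positivity)).add
      (integrable_mul_exp_neg_mul_sq (by positivity))).const_mul _
  refine h1.integrableOn.mono' ?_ ((ae_restrict_iff' measurableSet_Ioi).2 (.of_forall ?_))
  · exact Measurable.aestronglyMeasurable (by fun_prop)
  · intro ρ hρ
    have hρ : 0 < ρ := hρ
    rw [norm_smul, Real.norm_of_nonneg (by positivity), Real.norm_eq_abs]
    have h2 := abs_exp_neg_sub_exp_neg_le_add ((b * ρ) ^ 2) ((c * ρ) ^ 2)
    rw [mul_pow, mul_pow, ← sub_mul, abs_mul, abs_of_nonneg (sq_nonneg ρ)] at h2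
    rw [mul_pow, mul_pow]
    calc _ ≤ ρ⁻¹ * _ := mul_le_mul_of_nonneg_left h2 (by positivity)
      _ = _ := by
        rw [neg_mul, neg_mul]
        field_simp

lemma integral_inv_mul_exp_sub_exp {b c : ℝ} (hb : 0 < b) (hc : 0 < c) :
    ∫ ρ in Set.Ioi (0 : ℝ), ρ⁻¹ • (Real.exp (-(b * ρ) ^ 2) - Real.exp (-(c * ρ) ^ 2)) =
      Real.log (c / b) := by
  have hcont : Continuous (fun ρ : ℝ => Real.exp (-ρ ^ 2)) := by fun_prop
  have h := Frullani.integral_Ioi_eq (f := fun ρ : ℝ => Real.exp (-ρ ^ 2)) (L := 1) (R := 0)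
    (hcont.locallyIntegrable.locallyIntegrableOn _) hb hc
    (by simpa using (hcont.tendsto 0).mono_left nhdsWithin_le_nhds)
    (Real.tendsto_exp_neg_atTop_nhds_zero.comp (tendsto_pow_atTop two_ne_zero))
    (integrableOn_inv_mul_exp_sub_exp hb hc)
  simpa using h

variable {d : ℕ}

lemma pow_pred_mul_mul_inv_pow (hd : 1 ≤ d) {ρ : ℝ} (hρ : 0 < ρ) (z : ℝ) :
    ρ ^ (d - 1) * (z * (ρ ^ d)⁻¹) = ρ⁻¹ * z := by
  obtain ⟨k, rfl⟩ := Nat.exists_eq_add_of_le' hd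
  rw [Nat.add_sub_cancel, pow_succ]
  field_simp

lemma integrable_gaussian_sub_mul_norm_inv_pow (hd : 1 ≤ d) {b c : ℝ} (hb : 0 < b) (hc : 0 < c) :
    Integrable (fun y : EuclideanSpace ℝ (Fin d) =>
      (Real.exp (-(b * ‖y‖) ^ 2) - Real.exp (-(c * ‖y‖) ^ 2)) * (‖y‖ ^ d)⁻¹) := by
  have : Nontrivial (EuclideanSpace ℝ (Fin d)) :=
    Module.nontrivial_of_finrank_pos (R := ℝ) (by simpa using Nat.pos_of_ne_zero (by omega))
  refine (integrable_fun_norm_addHaar volume (f := fun ρ =>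
    (Real.exp (-(b * ρ) ^ 2) - Real.exp (-(c * ρ) ^ 2)) * (ρ ^ d)⁻¹)).2 ?_
  refine (integrableOn_inv_mul_exp_sub_exp hb hc).congr_fun (fun ρ hρ => ?_) measurableSet_Ioi
  simp only [finrank_euclideanSpace_fin, smul_eq_mul]
  exact (pow_pred_mul_mul_inv_pow hd hρ _).symm

lemma integral_gaussian_sub_mul_norm_inv_pow (hd : 1 ≤ d) {b c : ℝ} (hb : 0 < b) (hc : 0 < c) :
    ∫ y : EuclideanSpace ℝ (Fin d),
      (Real.exp (-(b * ‖y‖) ^ 2) - Real.exp (-(c * ‖y‖) ^ 2)) * (‖y‖ ^ d)⁻¹ =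
      d * volume.real (Metric.ball (0 : EuclideanSpace ℝ (Fin d)) 1) * Real.log (c / b) := by
  have : Nontrivial (EuclideanSpace ℝ (Fin d)) :=
    Module.nontrivial_of_finrank_pos (R := ℝ) (by simpa using Nat.pos_of_ne_zero (by omega))
  rw [integral_fun_norm_addHaar volume (fun ρ =>
    (Real.exp (-(b * ρ) ^ 2) - Real.exp (-(c * ρ) ^ 2)) * (ρ ^ d)⁻¹),
    ← integral_inv_mul_exp_sub_exp hb hc, finrank_euclideanSpace_fin, nsmul_eq_mul, smul_eq_mul,
    mul_assoc]
  congr 2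
  refine setIntegral_congr_fun measurableSet_Ioi fun ρ hρ => ?_
  simp only [smul_eq_mul]
  exact pow_pred_mul_mul_inv_pow hd hρ _

/-- Both sides are the area of the unit sphere, the source of the constant in the theorem. -/
lemma natCast_mul_volume_ball (hd : 1 ≤ d) :
    d * volume.real (Metric.ball (0 : EuclideanSpace ℝ (Fin d)) 1) =
      (Real.Gamma ((d : ℝ) / 2) / (2 * Real.pi ^ ((d : ℝ) / 2)))⁻¹ := by
  have : Nonempty (Fin d) := ⟨⟨0, hd⟩⟩
  have hd0 : (0 : ℝ) < d := by exact_mod_cast hd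
  have hΓ := Real.Gamma_pos_of_pos (by positivity : (0 : ℝ) < d / 2)
  rw [Measure.real, EuclideanSpace.volume_ball, Real.Gamma_add_one (by positivity)]
  simp only [ENNReal.ofReal_one, one_pow, one_mul, Fintype.card_fin]
  rw [ENNReal.toReal_ofReal (by positivity), ← Real.rpow_natCast, Real.sqrt_eq_rpow,
    ← Real.rpow_mul Real.pi_pos.le, show (1 / 2 : ℝ) * d = d / 2 by ring]
  field_simp

end Frullani

/-! ### Comparison of a unimodal law with Lebesgue measure. -/

section Density

variable {d : ℕ} {μ : Measure (EuclideanSpace ℝ (Fin d))} {f : EuclideanSpace ℝ (Fin d) → ℝ≥0∞}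

lemma IsUnimodalDensity.apply_eq_lintegral (h : IsUnimodalDensity μ f)
    {S : Set (EuclideanSpace ℝ (Fin d))} (hS : MeasurableSet S) (h0 : (0 : _) ∉ S) :
    μ S = ∫⁻ z in S, f z := by
  have hsub : S ∩ {0}ᶜ = S := Set.inter_eq_left.2 fun z hz hz0 => h0 (hz0 ▸ hz)
  have h1 := congrArg (fun ν => ν S) h.restrict_eq
  rwa [Measure.restrict_apply hS, withDensity_apply _ hS, Measure.restrict_restrict hS, hsub] at h1

lemma IsUnimodalDensity.restrict_le (h : IsUnimodalDensity μ f) {x : EuclideanSpace ℝ (Fin d)}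
    (hx : x ≠ 0) {S : Set (EuclideanSpace ℝ (Fin d))} (hS : MeasurableSet S)
    (hSx : ∀ z ∈ S, ‖x‖ ≤ ‖z‖) : μ.restrict S ≤ f x • volume.restrict S := by
  have h0 : (0 : EuclideanSpace ℝ (Fin d)) ∉ S := fun h => hx (by simpa using hSx 0 h)
  refine Measure.le_iff.2 fun B hB => ?_
  rw [Measure.restrict_apply hB, Measure.smul_apply, Measure.restrict_apply hB,
    h.apply_eq_lintegral (hB.inter hS) fun h => h0 h.2, smul_eq_mul, ← setLIntegral_const]
  exact setLIntegral_mono' (hB.inter hS) fun z hz => h.antitone x z hx (hSx z hz.2)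

lemma IsUnimodalDensity.le_restrict (h : IsUnimodalDensity μ f) {x : EuclideanSpace ℝ (Fin d)}
    {S : Set (EuclideanSpace ℝ (Fin d))} (hS : MeasurableSet S) (h0 : (0 : _) ∉ S)
    (hSx : ∀ z ∈ S, ‖z‖ ≤ ‖x‖) : f x • volume.restrict S ≤ μ.restrict S := by
  refine Measure.le_iff.2 fun B hB => ?_
  rw [Measure.restrict_apply hB, Measure.smul_apply, Measure.restrict_apply hB,
    h.apply_eq_lintegral (hB.inter hS) fun h => h0 h.2, smul_eq_mul, ← setLIntegral_const]
  exact setLIntegral_mono' (hB.inter hS) fun z hz =>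
    h.antitone z x (fun h => h0 (h ▸ hz.2)) (hSx z hz.2)

/-- The ball with diameter from 0 to x avoids 0 and lies in |z| ≤ |x|, where the density is at least
its value at x; an infinite value would give this ball infinite mass. -/
lemma IsUnimodalDensity.ne_top [IsFiniteMeasure μ] (h : IsUnimodalDensity μ f)
    {x : EuclideanSpace ℝ (Fin d)} (hx : x ≠ 0) : f x ≠ ∞ := by
  have hxn : 0 < ‖x‖ := norm_pos_iff.2 hx
  set S := Metric.ball ((1 / 2 : ℝ) • x) (‖x‖ / 2)
  have hn : ‖(1 / 2 : ℝ) • x‖ = ‖x‖ / 2 := by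
    rw [norm_smul]; norm_num; ring
  have h0 : (0 : EuclideanSpace ℝ (Fin d)) ∉ S := by
    simp only [S, Metric.mem_ball, dist_zero_left, hn, lt_irrefl, not_false_eq_true]
  have hle := h.le_restrict (x := x) (S := S) measurableSet_ball h0 fun z hz => by
    have h1 : dist z ((1 / 2 : ℝ) • x) < ‖x‖ / 2 := hz
    rw [dist_eq_norm] at h1
    have h2 := norm_le_norm_add_norm_sub' z ((1 / 2 : ℝ) • x)
    linarith
  have h3 := hle S
  rw [Measure.smul_apply, Measure.restrict_apply_self, Measure.restrict_apply_self] at h3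
  have hpos : volume S ≠ 0 := (Metric.measure_ball_pos volume _ (by positivity)).ne'
  intro htop
  rw [htop, smul_eq_mul, ENNReal.top_mul hpos, top_le_iff] at h3
  exact measure_ne_top μ S h3

lemma setIntegral_eq_of_ne_zero {ν : Measure (EuclideanSpace ℝ (Fin d))}
    {k : EuclideanSpace ℝ (Fin d) → ℝ} {S : Set (EuclideanSpace ℝ (Fin d))}
    (hk : ∀ z, k z ≠ 0 → z ∈ S) : ∫ z in S, k z ∂ν = ∫ z, k z ∂ν :=
  setIntegral_eq_integral_of_forall_compl_eq_zero fun z hz => by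
    by_contra h; exact hz (hk z h)

/-- Testing outside the sphere through x bounds the density at x from below; testing inside, as in
`IsUnimodalDensity.le_integral`, bounds it from above. -/
lemma IsUnimodalDensity.integral_le [IsFiniteMeasure μ] (h : IsUnimodalDensity μ f)
    {x : EuclideanSpace ℝ (Fin d)} (hx : x ≠ 0) {k : EuclideanSpace ℝ (Fin d) → ℝ}
    (hk0 : ∀ z, 0 ≤ k z) (hki : Integrable k) (hkx : ∀ z, k z ≠ 0 → ‖x‖ ≤ ‖z‖) :
    ∫ z, k z ∂μ ≤ (f x).toReal * ∫ z, k z := by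
  have hS : MeasurableSet {z : EuclideanSpace ℝ (Fin d) | ‖x‖ ≤ ‖z‖} :=
    measurableSet_le measurable_const measurable_norm
  rw [← setIntegral_eq_of_ne_zero (ν := μ) hkx, ← setIntegral_eq_of_ne_zero (ν := volume) hkx,
    ← smul_eq_mul, ← integral_smul_measure]
  exact integral_mono_measure (h.restrict_le hx hS fun z hz => hz) (.of_forall hk0)
    (hki.restrict.smul_measure (h.ne_top hx))

lemma IsUnimodalDensity.le_integral (h : IsUnimodalDensity μ f)
    {x : EuclideanSpace ℝ (Fin d)} {k : EuclideanSpace ℝ (Fin d) → ℝ}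
    (hk0 : ∀ z, 0 ≤ k z) (hki : Integrable k μ) (hk : k 0 = 0)
    (hkx : ∀ z, k z ≠ 0 → ‖z‖ ≤ ‖x‖) :
    (f x).toReal * ∫ z, k z ≤ ∫ z, k z ∂μ := by
  have hS : MeasurableSet ({z : EuclideanSpace ℝ (Fin d) | ‖z‖ ≤ ‖x‖} \ {0}) :=
    (measurableSet_le measurable_norm measurable_const).diff (measurableSet_singleton 0)
  have hkS : ∀ z, k z ≠ 0 → z ∈ {z : EuclideanSpace ℝ (Fin d) | ‖z‖ ≤ ‖x‖} \ {0} :=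
    fun z hz => ⟨hkx z hz, fun h0 => hz (by rw [Set.mem_singleton_iff.1 h0, hk])⟩
  rw [← setIntegral_eq_of_ne_zero (ν := μ) hkS, ← setIntegral_eq_of_ne_zero (ν := volume) hkS,
    ← smul_eq_mul, ← integral_smul_measure]
  exact integral_mono_measure (h.le_restrict hS (by simp) fun z hz => hz.1) (.of_forall hk0)
    hki.restrict

end Density

/-! ### Radial test functions on annuli. -/

section Bump

variable {d : ℕ}

/-- A nonnegative radial test function supported in the annulus `α < ‖y‖ < β`. -/
lemma exists_radial_bump (hd : 1 ≤ d) {α β : ℝ} (hα : 0 < α) (hαβ : α < β) :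
    ∃ h : ℝ → ℝ, Continuous h ∧ ∃ k : EuclideanSpace ℝ (Fin d) → ℝ,
      (∀ y, k y = h (Real.exp (-‖y‖ ^ 2)) * (Real.exp (-‖y‖ ^ 2) *
        (1 - Real.exp (-‖y‖ ^ 2)))) ∧
      Continuous k ∧ HasCompactSupport k ∧ (∀ y, 0 ≤ k y) ∧
      (∀ y, k y ≠ 0 → α < ‖y‖ ∧ ‖y‖ < β) ∧ 0 < ∫ y, k y := by
  have hexp : ∀ {a b : ℝ}, 0 ≤ a → 0 ≤ b →
      (Real.exp (-a ^ 2) < Real.exp (-b ^ 2) ↔ b < a) := fun ha hb => by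
    rw [Real.exp_lt_exp, neg_lt_neg_iff, sq_lt_sq₀ hb ha]
  -- Since w = exp(-|y|²) decreases in |y|, the annulus is the window exp(-β²) < w < exp(-α²).
  let h : ℝ → ℝ := fun w => max 0 (w - Real.exp (-β ^ 2)) * max 0 (Real.exp (-α ^ 2) - w)
  have hh : Continuous h := by fun_prop
  let k : EuclideanSpace ℝ (Fin d) → ℝ := fun y =>
    h (Real.exp (-‖y‖ ^ 2)) * (Real.exp (-‖y‖ ^ 2) * (1 - Real.exp (-‖y‖ ^ 2)))
  have hkc : Continuous k := by fun_prop
  have hk0 : ∀ y, 0 ≤ k y := fun y => by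
    have : Real.exp (-‖y‖ ^ 2) ≤ 1 := Real.exp_le_one_iff.2 (by nlinarith [sq_nonneg ‖y‖])
    exact mul_nonneg (mul_nonneg (le_max_left _ _) (le_max_left _ _))
      (mul_nonneg (Real.exp_pos _).le (by linarith))
  have hks : ∀ y, k y ≠ 0 → α < ‖y‖ ∧ ‖y‖ < β := by
    intro y hy
    by_contra hcon
    apply hy
    rw [not_and_or, not_lt, not_lt] at hcon
    rcases hcon with hc | hc
    · have : Real.exp (-α ^ 2) - Real.exp (-‖y‖ ^ 2) ≤ 0 := by
        rw [sub_nonpos, ← not_lt, hexp (norm_nonneg _) hα.le]; exact not_lt.2 hc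
      simp [k, h, max_eq_left this]
    · have : Real.exp (-‖y‖ ^ 2) - Real.exp (-β ^ 2) ≤ 0 := by
        rw [sub_nonpos, ← not_lt, hexp (hα.trans hαβ).le (norm_nonneg _)]; exact not_lt.2 hc
      simp [k, h, max_eq_left this]
  have hcs : HasCompactSupport k :=
    HasCompactSupport.of_support_subset_isCompact (isCompact_closedBall 0 β) fun y hy => by
      simpa using (hks y hy).2.le
  refine ⟨h, hh, k, fun _ => rfl, hkc, hcs, hk0, hks, ?_⟩
  let e : EuclideanSpace ℝ (Fin d) := EuclideanSpace.single ⟨0, hd⟩ ((α + β) / 2)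
  have he : ‖e‖ = (α + β) / 2 := by
    simp only [e, PiLp.norm_single]
    exact Real.norm_of_nonneg (by linarith)
  refine hkc.integral_pos_of_hasCompactSupport_nonneg_nonzero hcs hk0 (x := e) (ne_of_gt ?_)
  have h1 : Real.exp (-β ^ 2) < Real.exp (-‖e‖ ^ 2) :=
    (hexp (by linarith) (norm_nonneg _)).2 (by linarith)
  have h2 : Real.exp (-‖e‖ ^ 2) < Real.exp (-α ^ 2) :=
    (hexp (norm_nonneg _) hα.le).2 (by linarith)
  have h3 : Real.exp (-‖e‖ ^ 2) < 1 := h2.trans (Real.exp_lt_one_iff.2 (by nlinarith))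
  exact mul_pos (mul_pos (lt_max_of_lt_right (by linarith)) (lt_max_of_lt_right (by linarith)))
    (mul_pos (Real.exp_pos _) (by linarith))

end Bump

/-! ### Weak convergence of the rescaled laws and passage to the density. -/

section Asymptotics

variable {d : ℕ}

lemma exp_neg_sq_pow (z : ℝ) (k : ℕ) :
    Real.exp (-z ^ 2) ^ k = Real.exp (-(√(k : ℝ) * z) ^ 2) := by
  rw [← Real.exp_nat_mul, mul_pow, Real.sq_sqrt (Nat.cast_nonneg k)]
  ring_nf

lemma exp_neg_sq_mem_Icc (z : ℝ) : Real.exp (-z ^ 2) ∈ Set.Icc (0 : ℝ) 1 :=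
  ⟨(Real.exp_pos _).le, Real.exp_le_one_iff.2 (by nlinarith [sq_nonneg z])⟩

/-- Asymptotics of unimodal densities of measures with characteristic functions
`exp (-t ψ(‖ξ‖))`, for `ψ` in the de Haan class of `ℓ`. -/
theorem tendsto_unimodal_density (hd : 1 ≤ d) {ψ ℓ : ℝ → ℝ} (hψc : ContinuousOn ψ (Set.Ici 0))
    (hψ0 : ∀ r, 0 ≤ r → 0 ≤ ψ r)
    (hψℓ : ∀ c, 0 < c → Tendsto (fun x => (ψ (c * x) - ψ x) / ℓ x) atTop (𝓝 (Real.log c)))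
    (hℓ : ∀ c, 0 < c → Tendsto (fun x => ℓ (c * x) / ℓ x) atTop (𝓝 1))
    (hℓ0 : ∀ᶠ x in atTop, 0 ≤ ℓ x) {M : ℝ} (hM : ∀ᶠ x in atTop, ℓ x ≤ M)
    {ι : Type*} {l : Filter ι} [l.IsCountablyGenerated] {t : ι → ℝ}
    {x : ι → EuclideanSpace ℝ (Fin d)} (hx : ∀ᶠ i in l, x i ≠ 0)
    (ht : Tendsto t l (𝓝[>] 0)) (hr : Tendsto (fun i => ‖x i‖⁻¹) l atTop)
    (htψ : Tendsto (fun i => t i * ψ (‖x i‖⁻¹)) l atTop)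
    (μ : ι → Measure (EuclideanSpace ℝ (Fin d))) [∀ i, IsProbabilityMeasure (μ i)]
    (hμ : ∀ i ξ, charFun (μ i) ξ = (Real.exp (-(t i * ψ ‖ξ‖)) : ℂ))
    {f : ι → EuclideanSpace ℝ (Fin d) → ℝ≥0∞} (hf : ∀ᶠ i in l, IsUnimodalDensity (μ i) (f i)) :
    Tendsto (fun i => (f i (x i)).toReal /
      (t i * (‖x i‖ ^ d)⁻¹ * ℓ (‖x i‖⁻¹) * Real.exp (-(t i * ψ (‖x i‖⁻¹))))) l
      (𝓝 (Real.Gamma ((d : ℝ) / 2) / (2 * Real.pi ^ ((d : ℝ) / 2)))) := by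
  set κ := Real.Gamma ((d : ℝ) / 2) / (2 * Real.pi ^ ((d : ℝ) / 2)) with hκ
  have hd0 : (0 : ℝ) < d := by exact_mod_cast hd
  have hκ0 : 0 < κ := div_pos (Real.Gamma_pos_of_pos (by positivity)) (by positivity)
  set r : ι → ℝ := fun i => ‖x i‖⁻¹
  have hr0 : ∀ i, 0 ≤ r i := fun i => inv_nonneg.2 (norm_nonneg _)
  set W : ι → ℝ := fun i => t i * ℓ (r i) * Real.exp (-(t i * ψ (r i))) 
  have hℓpos : ∀ᶠ z in atTop, 0 < ℓ z := by
    filter_upwards [hℓ0, (hℓ 1 one_pos).eventually_ne one_ne_zero] with z hz hne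
    refine lt_of_le_of_ne hz fun h0 => hne ?_
    rw [← h0, div_zero]
  have hW : ∀ᶠ i in l, 0 < W i := by
    filter_upwards [(tendsto_nhdsWithin_iff.1 ht).2, hr.eventually hℓpos] with i h1 h2
    exact mul_pos (mul_pos h1 h2) (Real.exp_pos _)
  -- weak convergence of the normalised measures away from the origin
  let u : ι → EuclideanSpace ℝ (Fin d) → ℝ := fun i y => Real.exp (-(r i * ‖y‖) ^ 2)
  -- The factor 1 - u vanishes at the origin, which removes a possible atom of the law and, in m',
  -- makes |y|^{-d} integrable there; the factor u handles infinity.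
  let m : ι → EuclideanSpace ℝ (Fin d) → ℝ := fun i y => u i y * (1 - u i y) / W i
  let u' : EuclideanSpace ℝ (Fin d) → ℝ := fun y => Real.exp (-‖y‖ ^ 2)
  let m' : EuclideanSpace ℝ (Fin d) → ℝ := fun y => u' y * (1 - u' y) * (‖y‖ ^ d)⁻¹ * κ
  have hm : ∀ i, Integrable (m i) (μ i) := by
    intro i
    refine Integrable.div_const (Integrable.of_bound (C := 1)
      (Continuous.aestronglyMeasurable (by fun_prop)) (.of_forall fun y => ?_)) _
    obtain ⟨h0, h1⟩ := exp_neg_sq_mem_Icc (r i * ‖y‖)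
    rw [Real.norm_of_nonneg (mul_nonneg h0 (sub_nonneg.2 h1))]
    exact mul_le_one₀ h1 (sub_nonneg.2 h1) (by linarith)
  have hm0 : ∀ᶠ i in l, ∀ y, 0 ≤ m i y := hW.mono fun i hi y => by
    obtain ⟨h0, h1⟩ := exp_neg_sq_mem_Icc (r i * ‖y‖)
    exact div_nonneg (mul_nonneg h0 (sub_nonneg.2 h1)) hi.le
  have hsqrt : ∀ n : ℕ, 0 < √((n + 1 : ℕ) : ℝ) := fun n => Real.sqrt_pos.2 (by positivity)
  -- Powers of a Gaussian are Gaussians, so each weighted moment is a difference at the scales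
  -- √(n+1) and √(n+2).
  have hpow : ∀ (n : ℕ) (z : ℝ), Real.exp (-z ^ 2) ^ n *
      (Real.exp (-z ^ 2) * (1 - Real.exp (-z ^ 2))) =
      Real.exp (-(√((n + 1 : ℕ) : ℝ) * z) ^ 2) - Real.exp (-(√((n + 1 + 1 : ℕ) : ℝ) * z) ^ 2) := by
    intro n z
    rw [← exp_neg_sq_pow, ← exp_neg_sq_pow]
    ring
  have hm'eq : ∀ (n : ℕ) y, u' y ^ n * m' y = (Real.exp (-(√((n + 1 : ℕ) : ℝ) * ‖y‖) ^ 2) -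
      Real.exp (-(√((n + 1 + 1 : ℕ) : ℝ) * ‖y‖) ^ 2)) * (‖y‖ ^ d)⁻¹ * κ := by
    intro n y
    rw [← hpow]
    simp only [u', m']
    ring
  have hm' : Integrable m' := by
    refine ((integrable_gaussian_sub_mul_norm_inv_pow hd (hsqrt 0) (hsqrt 1)).mul_const κ).congr
      (.of_forall fun y => ?_)
    simpa using (hm'eq 0 y).symm
  have hm0' : ∀ y, 0 ≤ m' y := fun y => by
    obtain ⟨h0, h1⟩ := exp_neg_sq_mem_Icc ‖y‖
    exact mul_nonneg (mul_nonneg (mul_nonneg h0 (sub_nonneg.2 h1)) (by positivity)) hκ0.le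
  have hmom : ∀ n : ℕ, Tendsto (fun i => ∫ y, u i y ^ n * m i y ∂μ i) l
      (𝓝 (∫ y, u' y ^ n * m' y)) := by
    intro n
    have h1 : ∫ y, u' y ^ n * m' y = Real.log (√((n + 1 + 1 : ℕ) : ℝ) / √((n + 1 : ℕ) : ℝ)) := by
      simp_rw [hm'eq]
      rw [integral_mul_const, integral_gaussian_sub_mul_norm_inv_pow hd (hsqrt n) (hsqrt (n + 1)),
        natCast_mul_volume_ball hd, ← hκ]
      field_simp
    rw [h1]
    refine (tendsto_gaussian_transform hd hψc hψ0 hψℓ hℓ hℓ0 hM ht hr htψ μ hμ (hsqrt n)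
      (hsqrt (n + 1))).congr fun i => ?_
    have hint : ∀ b : ℝ, Integrable (fun y : EuclideanSpace ℝ (Fin d) =>
        Real.exp (-(b * (r i * ‖y‖)) ^ 2)) (μ i) := fun b =>
      Integrable.of_bound (C := 1) (Continuous.aestronglyMeasurable (by fun_prop))
        (.of_forall fun y => by
          obtain ⟨h0, h1⟩ := exp_neg_sq_mem_Icc (b * (r i * ‖y‖))
          rwa [Real.norm_of_nonneg h0])
    rw [← integral_sub (hint _) (hint _), ← integral_div]
    refine integral_congr_ae (.of_forall fun y => ?_)
    simp only [u, m]
    rw [← mul_div_assoc, hpow]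
  have hweak : ∀ {h : ℝ → ℝ} {k : EuclideanSpace ℝ (Fin d) → ℝ}, Continuous h →
      (∀ y, k y = h (Real.exp (-‖y‖ ^ 2)) * (Real.exp (-‖y‖ ^ 2) *
        (1 - Real.exp (-‖y‖ ^ 2)))) →
      Tendsto (fun i => (∫ y, k (r i • y) ∂μ i) / W i) l
        (𝓝 (κ * ∫ y, k y * (‖y‖ ^ d)⁻¹)) := by
    intro h k hh hk
    have := tendsto_integral_comp_of_moments (μ := μ) (u := u) (m := m) (u' := u') (m' := m')
      (fun i => Continuous.measurable (by fun_prop)) (fun i y => exp_neg_sq_mem_Icc _) hm hm0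
      (Continuous.measurable (by fun_prop)) (fun y => exp_neg_sq_mem_Icc _) hm' hm0' hmom hh
    convert! this using 1
    · ext i
      rw [← integral_div]
      refine integral_congr_ae (.of_forall fun y => ?_)
      simp only [u, m, hk, norm_smul, Real.norm_of_nonneg (hr0 i)]
      ring
    · rw [← integral_const_mul]
      congr 1
      refine integral_congr_ae (.of_forall fun y => ?_)
      simp only [u', m', hk]
      ring
  have hscale : ∀ i, ∀ k : EuclideanSpace ℝ (Fin d) → ℝ,
      ∫ y, k (r i • y) = ‖x i‖ ^ d * ∫ y, k y := by
    intro i k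
    rw [Measure.integral_comp_smul, finrank_euclideanSpace_fin, smul_eq_mul]
    simp only [r, inv_pow, inv_inv]
    rw [abs_of_nonneg (by positivity)]
  have hquot : ∀ i, (f i (x i)).toReal /
      (t i * (‖x i‖ ^ d)⁻¹ * ℓ (r i) * Real.exp (-(t i * ψ (r i)))) =
      (f i (x i)).toReal * ‖x i‖ ^ d / W i := by
    intro i
    simp only [W, div_eq_mul_inv, mul_inv, inv_inv]
    ring
  have hnorm : ∀ i, x i ≠ 0 → ∀ z : EuclideanSpace ℝ (Fin d), ‖r i • z‖ = ‖z‖ / ‖x i‖ := fun i hi z => by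
    rw [norm_smul, Real.norm_of_nonneg (hr0 i)]; simp only [r]; ring
  have hcompare : ∀ {k : EuclideanSpace ℝ (Fin d) → ℝ} {α β : ℝ}, 0 < α → Continuous k →
      HasCompactSupport k → (∀ y, 0 ≤ k y) → (∀ y, k y ≠ 0 → α < ‖y‖ ∧ ‖y‖ < β) →
      (β ^ d)⁻¹ * ∫ y, k y ≤ ∫ y, k y * (‖y‖ ^ d)⁻¹ ∧
        ∫ y, k y * (‖y‖ ^ d)⁻¹ ≤ (α ^ d)⁻¹ * ∫ y, k y := by
    intro k α β hα hkc hkcs hk0 hks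
    have hki : Integrable k := hkc.integrable_of_hasCompactSupport hkcs
    have hle : ∀ y, k y * (‖y‖ ^ d)⁻¹ ≤ (α ^ d)⁻¹ * k y := fun y => by
      rcases eq_or_ne (k y) 0 with h0 | h0
      · simp [h0]
      · have := (hks y h0).1
        have := hk0 y
        rw [mul_comm]
        gcongr
    have hge : ∀ y, (β ^ d)⁻¹ * k y ≤ k y * (‖y‖ ^ d)⁻¹ := fun y => by
      rcases eq_or_ne (k y) 0 with h0 | h0
      · simp [h0]
      · have h1 := (hks y h0).1
        have h2 := (hks y h0).2
        have := hk0 y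
        have : 0 < ‖y‖ := hα.trans h1
        rw [mul_comm]
        gcongr
    have hi : Integrable (fun y => k y * (‖y‖ ^ d)⁻¹) := by
      refine (hki.const_mul (α ^ d)⁻¹).mono' (Measurable.aestronglyMeasurable ?_)
        (.of_forall fun y => ?_)
      · exact hkc.measurable.mul (by fun_prop)
      · rw [Real.norm_of_nonneg (mul_nonneg (hk0 y) (by positivity))]
        exact hle y
    rw [← integral_const_mul, ← integral_const_mul]
    exact ⟨integral_mono (hki.const_mul _) hi hge, integral_mono hi (hki.const_mul _) hle⟩
  refine Tendsto.congr (fun i => (hquot i).symm) ?_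
  refine tendsto_order.2 ⟨fun b hb => ?_, fun b hb => ?_⟩
  -- Lower bound: a bump on 1 < |y| < β, with β so close to 1 that bβ^d < κ, rescales to points
  -- outside |x|, where the density is at most its value at x.
  · have hcont : Tendsto (fun β : ℝ => b * β ^ d) (𝓝[>] 1) (𝓝 b) := by
      have : Continuous (fun β : ℝ => b * β ^ d) := by fun_prop
      simpa using (this.tendsto 1).mono_left nhdsWithin_le_nhds
    obtain ⟨β, hβκ, hβ⟩ := ((hcont.eventually_lt_const hb).and self_mem_nhdsWithin).exists
    have hβ : (1 : ℝ) < β := hβ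
    obtain ⟨h, hh, k, hk, hkc, hkcs, hk0, hks, hkpos⟩ := exists_radial_bump hd one_pos hβ
    have hlim : b * ∫ y, k y < κ * ∫ y, k y * (‖y‖ ^ d)⁻¹ := by
      refine lt_of_lt_of_le ?_ (mul_le_mul_of_nonneg_left
        (hcompare one_pos hkc hkcs hk0 hks).1 hκ0.le)
      rw [← mul_assoc]
      refine mul_lt_mul_of_pos_right ?_ hkpos
      rwa [← div_eq_mul_inv, lt_div_iff₀ (by positivity)]
    filter_upwards [(hweak hh hk).eventually_const_lt hlim, hW, hx, hf] with i h1 h2 h3 h4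
    have hxi : 0 < ‖x i‖ := norm_pos_iff.2 h3
    have h5 := h4.integral_le h3 (k := fun z => k (r i • z)) (fun z => hk0 _)
      ((integrable_comp_smul_iff volume k (inv_ne_zero hxi.ne')).2
        (hkc.integrable_of_hasCompactSupport hkcs))
      (fun z hz => by
        have := (hks _ hz).1
        rw [hnorm i h3, one_lt_div hxi] at this
        exact this.le)
    rw [hscale, ← mul_assoc] at h5
    have h6 := h1.trans_le (div_le_div_of_nonneg_right h5 h2.le)
    rw [mul_div_right_comm] at h6
    exact lt_of_mul_lt_mul_right h6 hkpos.le
  -- Upper bound: symmetrically, a bump on α < |y| < 1 with κ < bα^d sees only points where the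
  -- density is at least its value at x.
  · have hcont : Tendsto (fun α : ℝ => b * α ^ d) (𝓝[<] 1) (𝓝 b) := by
      have : Continuous (fun α : ℝ => b * α ^ d) := by fun_prop
      simpa using (this.tendsto 1).mono_left nhdsWithin_le_nhds
    obtain ⟨α, hακ, hα0, hα1⟩ := ((hcont.eventually_const_lt hb).and
      (Ioo_mem_nhdsLT zero_lt_one)).exists
    obtain ⟨h, hh, k, hk, hkc, hkcs, hk0, hks, hkpos⟩ := exists_radial_bump hd hα0 hα1
    have hlim : κ * ∫ y, k y * (‖y‖ ^ d)⁻¹ < b * ∫ y, k y := by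
      refine lt_of_le_of_lt (mul_le_mul_of_nonneg_left
        (hcompare hα0 hkc hkcs hk0 hks).2 hκ0.le) ?_
      rw [← mul_assoc]
      refine mul_lt_mul_of_pos_right ?_ hkpos
      rwa [← div_eq_mul_inv, div_lt_iff₀ (by positivity)]
    filter_upwards [(hweak hh hk).eventually_lt_const hlim, hW, hx, hf] with i h1 h2 h3 h4
    have hxi : 0 < ‖x i‖ := norm_pos_iff.2 h3
    have hkr : Continuous fun z => k (r i • z) := hkc.comp (continuous_const_smul _)
    obtain ⟨C, hC⟩ := hkcs.exists_bound_of_continuous hkc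
    have h5 := h4.le_integral (x := x i) (k := fun z => k (r i • z)) (fun z => hk0 _)
      (Integrable.of_bound (C := C) hkr.aestronglyMeasurable (.of_forall fun z => hC _))
      (by
        by_contra h0
        have := (hks _ h0).1
        simp only [smul_zero, norm_zero] at this
        linarith)
      (fun z hz => by
        have := (hks _ hz).2
        rw [hnorm i h3, div_lt_one hxi] at this
        exact this.le)
    rw [hscale, ← mul_assoc] at h5
    have h6 := (div_le_div_of_nonneg_right h5 h2.le).trans_lt h1
    rw [mul_div_right_comm] at h6
    exact lt_of_mul_lt_mul_right h6 hkpos.le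

end Asymptotics

/-! ### The theorem for Lévy processes. -/

theorem theorem3p9 {d : ℕ} (hd : 1 ≤ d) {Ω : Type*} [MeasurableSpace Ω]
    (P : Measure Ω) [IsProbabilityMeasure P]
    (X : ℝ≥0 → Ω → EuclideanSpace ℝ (Fin d))
    (hX : IsIsotropicUnimodalLevyProcess X P)
    -- the process is pure jump, with Lévy measure `ν`
    (ν : Measure (EuclideanSpace ℝ (Fin d))) (hν : IsPureJumpWithLevyMeasure X P ν)
    -- `p t` is the radially non-increasing density of the law of `X t` off the origin
    (p : ℝ≥0 → EuclideanSpace ℝ (Fin d) → ℝ≥0∞)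
    (hp : ∀ t : ℝ≥0, 0 < t → IsUnimodalDensity (P.map (X t)) (p t))
    -- `ψ` is the radial profile of the Lévy–Khintchine exponent
    (ψ : ℝ → ℝ) (hψ : ∀ ξ : EuclideanSpace ℝ (Fin d), ψ ‖ξ‖ = levyExponent ν ξ)
    (a : ℝ) (ℓ : ℝ → ℝ) (hℓ : IsSlowlyVaryingAtInfty a ℓ)
    (hbdd : ∃ M : ℝ, ∀ x : ℝ, a ≤ x → ℓ x ≤ M)
    (hψℓ : IsDeHaanAtInfty a ℓ ψ) :
    Tendsto
      (fun q : ℝ≥0 × EuclideanSpace ℝ (Fin d) =>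
        (p q.1 q.2).toReal /
          ((q.1 : ℝ) * (‖q.2‖ ^ d)⁻¹ * ℓ (‖q.2‖⁻¹) * Real.exp (-((q.1 : ℝ) * ψ (‖q.2‖⁻¹)))))
      -- the limit is along pairs `(t, x)` with `x ≠ 0`, `t → 0⁺` and `t ψ(1/|x|) → ∞`
      (comap Prod.fst (𝓝[>] (0 : ℝ≥0)) ⊓
        comap (fun q : ℝ≥0 × EuclideanSpace ℝ (Fin d) => (q.1 : ℝ) * ψ (‖q.2‖⁻¹)) atTop ⊓
        𝓟 {q | q.2 ≠ 0})
      (𝓝 (Real.Gamma ((d : ℝ) / 2) / (2 * Real.pi ^ ((d : ℝ) / 2)))) := by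

  have hprob : ∀ s, IsProbabilityMeasure (P.map (X s)) := fun s =>
    Measure.isProbabilityMeasure_map (hX.measurable s).aemeasurable
  let e : EuclideanSpace ℝ (Fin d) := EuclideanSpace.single ⟨0, hd⟩ 1
  have he : ∀ r : ℝ, 0 ≤ r → ‖r • e‖ = r := fun r hr => by
    rw [norm_smul, Real.norm_of_nonneg hr]; simp [e]
  have hchar : ∀ (s : ℝ≥0) ξ, charFun (P.map (X s)) ξ = (Real.exp (-((s : ℝ) * ψ ‖ξ‖)) : ℂ) := by
    intro s ξ
    rw [hν.charFun_eq, hψ, Complex.ofReal_exp, Complex.ofReal_neg]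
  -- Reading ψ off the characteristic function of X 1 along a unit vector yields its nonnegativity
  -- and continuity on [0,∞).
  have hψlog : ∀ r : ℝ, 0 ≤ r → ψ r = -Real.log ‖charFun (P.map (X 1)) (r • e)‖ := by
    intro r hr
    rw [hchar, he r hr, Complex.norm_real, Real.norm_of_nonneg (Real.exp_pos _).le, Real.log_exp]
    simp
  have hψ0 : ∀ r, 0 ≤ r → 0 ≤ ψ r := fun r hr => by
    rw [hψlog r hr, neg_nonneg]
    exact Real.log_nonpos (norm_nonneg _) (norm_charFun_le_one _)
  have hψc : ContinuousOn ψ (Set.Ici 0) := by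
    refine ContinuousOn.congr (Continuous.continuousOn ?_) hψlog
    refine (Continuous.log ?_ fun r => ?_).neg
    · exact (continuous_charFun.comp (continuous_id.smul continuous_const)).norm
    · rw [hchar, Complex.norm_real]
      exact (norm_pos_iff.2 (Real.exp_pos _).ne').ne'
  obtain ⟨M, hM⟩ := hbdd
  set l : Filter (ℝ≥0 × EuclideanSpace ℝ (Fin d)) := comap Prod.fst (𝓝[>] (0 : ℝ≥0)) ⊓
    comap (fun q : ℝ≥0 × EuclideanSpace ℝ (Fin d) => (q.1 : ℝ) * ψ (‖q.2‖⁻¹)) atTop ⊓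
    𝓟 {q | q.2 ≠ 0}
  have hfst : Tendsto Prod.fst l (𝓝[>] (0 : ℝ≥0)) :=
    tendsto_comap.mono_left (inf_le_left.trans inf_le_left)
  have htψ : Tendsto (fun q : ℝ≥0 × EuclideanSpace ℝ (Fin d) => (q.1 : ℝ) * ψ (‖q.2‖⁻¹)) l atTop :=
    tendsto_comap.mono_left (inf_le_left.trans inf_le_right)
  have hne : ∀ᶠ q in l, q.2 ≠ 0 := mem_inf_of_right (mem_principal_self _)
  have hpos : ∀ᶠ q in l, 0 < q.1 := (tendsto_nhdsWithin_iff.1 hfst).2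
  have ht : Tendsto (fun q : ℝ≥0 × EuclideanSpace ℝ (Fin d) => (q.1 : ℝ)) l (𝓝[>] 0) :=
    tendsto_nhdsWithin_iff.2 ⟨(NNReal.tendsto_coe.2 (tendsto_nhdsWithin_iff.1 hfst).1),
      hpos.mono fun q hq => NNReal.coe_pos.2 hq⟩
  -- ψ is bounded on [0, R], so 1/|x| ≤ R would force tψ(1/|x|) < 1 for small t. Hence the two
  -- stated limits already imply x → 0.
  have hr : Tendsto (fun q : ℝ≥0 × EuclideanSpace ℝ (Fin d) => ‖q.2‖⁻¹) l atTop := by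
    refine tendsto_atTop.2 fun R => ?_
    obtain ⟨C, hC⟩ := isCompact_Icc.exists_bound_of_continuousOn (s := Set.Icc (0 : ℝ) R)
      (hψc.mono Set.Icc_subset_Ici_self)
    have hsmall : ∀ᶠ q : ℝ≥0 × EuclideanSpace ℝ (Fin d) in l, (q.1 : ℝ) * C < 1 :=
      (by simpa using (tendsto_nhdsWithin_iff.1 ht).1.mul_const C :
        Tendsto (fun q : ℝ≥0 × EuclideanSpace ℝ (Fin d) => (q.1 : ℝ) * C) l
          (𝓝 0)).eventually_lt_const one_pos
    filter_upwards [hsmall, htψ.eventually_ge_atTop 1] with q h1 h2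
    by_contra hcon
    have h3 := (le_abs_self _).trans (hC _ ⟨inv_nonneg.2 (norm_nonneg q.2), (not_le.1 hcon).le⟩)
    have := mul_le_mul_of_nonneg_left h3 q.1.coe_nonneg
    linarith
  exact tendsto_unimodal_density hd hψc hψ0 hψℓ.tendsto hℓ.tendsto
    ((eventually_ge_atTop a).mono hℓ.nonneg) ((eventually_ge_atTop a).mono hM) hne ht hr htψ
    (fun q => P.map (X q.1)) (fun q ξ => hchar q.1 ξ) (hpos.mono fun q hq => hp q.1 hq)
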